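/- **Setting.** Let $p,q,N\ge 1$ and $0\le r\le p-1$. Let $\mu=(\mu_{b,a})$ be a $q\times p$ matrix of (complex) measures on $\mathbb R$ with finite moments, supported in a closed set $\Delta\subseteq\mathbb R$. Let $R(x)=\sum_{l=0}^N R_lx^l$, $R_l\in\mathbb C^{p\times p}$, where $$R_N=\begin{bmatrix}0_{(p-r)\times r}&I_{p-r}\\0_{r\times r}&0_{r\times(p-r)}\end{bmatrix}$$ and the lower left $r\times r$ block of $R_{N-1}$ is $I_r$, and $\det R(x)\neq0$ for $x\in\Delta$. Let $x_1,\dots,x_M\in\mathbb C$ be the distinct zeros of $\det R$, with multiplicities $K_1,\dots,K_M$. For each $i$ fix a canonical set of left Jordan chains (rows $v^L_{i,j;k}$) and of right Jordan chains (columns $v^R_{i,j;k}$), $1\le j\le s_i$, $0\le k<\kappa_{i,j}$: that is, $\kappa_{i,j}\ge1$, $\sum_j\kappa_{i,j}=K_i$, $$\sum_{l=0}^k\tfrac1{l!}v^L_{i,j;k-l}R^{(l)}(x_i)=0,\qquad \sum_{l=0}^k\tfrac1{l!}R^{(l)}(x_i)v^R_{i,j;k-l}=0\qquad(0\le k<\kappa_{i,j}),$$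 and $(v^L_{i,j;0})_j$ and $(v^R_{i,j;0})_j$ are linearly independent. Let $\xi_{i,j,k}$ be column vector functions with $q$ entries, $k$ times continuously (complex) differentiable at $x_i$. The perturbed matrix of generalized measures is $$d\check\mu(x)=d\mu(x)R^{-1}(x)+\sum_{i=1}^M\sum_{j=1}^{s_i}\sum_{k=0}^{\kappa_{i,j}-1}\xi_{i,j,k}(x)\sum_{l=0}^k\frac{(-1)^l}{l!}v^L_{i,j;k-l}\,\delta^{(l)}(x-x_i),$$ acting on functions that are differentiable often enough at the $x_i$, with $\langle\delta^{(l)}(x-x_i),g\rangle=(-1)^lg^{(l)}(x_i)$. With $X_{[s]}(x)=(I_s,xI_s,x^2I_s,\dots)^\top$, assume that the moment matrix $\mathscr M=\int X_{[q]}\,d\mu\,X_{[p]}^\top$ has a Gauss–Borel factorization $\mathscr M=S^{-1}H\bar S^{-\top}$ ($S,\bar S$ lower unitriangular, $H$ diagonal and invertible), and likewise $\check{\mathscr M}=\int X_{[q]}\,d\check\mu\,X_{[p]}^\top=\check S^{-1}\check H\check{\bar S}^{-\top}$. Put $B(x)=SX_{[q]}(x)$ with rows $B_n=(B_n^{(1)},\dots,B_n^{(q)})$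 and $A(x)=X_{[p]}^\top(x)\bar S^\top H^{-1}$ with columns $A_n=(A_n^{(1)},\dots,A_n^{(p)})^\top$, and define $\check B_n,\check A_n$ in the same way from $\check{\mathscr M}$. Let $D_n(z)=\int B_n(x)\frac{d\mu(x)}{z-x}$. Let $\mathbb D_n^{(i)}$, $\mathbb W_n^{(i)}$ and $\mathbb P^{(i)}(x)$ be the rows of length $K_i$, with columns ordered lexicographically by $(j,k)$, whose columns are $$\mathbb D:\ \sum_{l=0}^k\frac1{l!}D_n^{(l)}(x_i)v^R_{i,j;k-l},\qquad \mathbb W:\ \lim_{x\to x_i}\sum_{l=0}^k\frac1{l!}F_{n,i}^{(l)}(x)\,v^R_{i,j;k-l},\qquad \mathbb P:\ \sum_{l=0}^k\frac{v^R_{i,j;k-l}}{(x-x_i)^{l+1}},$$ $$F_{n,i}(x)=\sum_{\tilde\jmath=1}^{s_i}\sum_{\tilde k=0}^{\kappa_{i,\tilde\jmath}-1}\sum_{\tilde l=0}^{\tilde k}\frac{(-1)^{\tilde l}}{\tilde l!}\Big\langle\delta^{(\tilde l)}(t-x_i),\frac{B_n(t)\xi_{i,\tilde\jmath,\tilde k}(t)}{x-t}\Big\rangle\,v^L_{i,\tilde\jmath;\tilde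 k-\tilde l}R(x).$$ ($\mathbb P^{(i)}$ has $p$ components $\mathbb P_a^{(i)}$.) Put $\mathbb K^{[m],(i)}(x)=\sum_{\nu=0}^{m}A_\nu(x)(\mathbb D^{(i)}_\nu-\mathbb W^{(i)}_\nu)$, with components $\mathbb K^{[m],(i)}_a$. Write $\mathbb E_n=(\mathbb D_n^{(1)}-\mathbb W_n^{(1)},\dots,\mathbb D_n^{(M)}-\mathbb W_n^{(M)})$, $\mathbb K^{[m]}_a=(\mathbb K^{[m],(1)}_a,\dots,\mathbb K^{[m],(M)}_a)$, $\mathbb P_a=(\mathbb P^{(1)}_a,\dots,\mathbb P^{(M)}_a)$, and let $\tau_n$ be the determinant of the matrix with rows $\mathbb E_{n-Np+r+1},\dots,\mathbb E_n$. **Theorem.** The total number $\sum_{i,j}\kappa_{i,j}$ of columns is $Np-r$; $d\check\mu(x)R(x)=d\mu(x)$ as functionals on polynomials; and the limits defining $\mathbb W$ exist. For every $n\ge Np-r$ one has $\tau_n\ne0$, $\tau_{n-1}\neq0$, and, for all $a\in\{1,\dots,p\}$, $b\in\{1,\dots,q\}$, $$\check A^{(a)}_n(x)=-\sum_{\tilde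 a=1}^p\frac{R_{a,\tilde a}(x)}{\tau_n}\begin{vmatrix}\mathbb E_{n-Np+r+1}\\\vdots\\\mathbb E_{n-1}\\\mathbb K^{[n-M]}_{\tilde a}(x)+\mathbb P_{\tilde a}(x)\end{vmatrix}\quad(\det R(x)\ne0),$$ $$\check B^{(b)}_n(x)=\frac1{\tau_{n-1}}\begin{vmatrix}\mathbb E_{n-Np+r}&B^{(b)}_{n-Np+r}(x)\\\vdots&\vdots\\\mathbb E_{n}&B^{(b)}_{n}(x)\end{vmatrix}\quad(x\in\mathbb C).$$ -/

import Mathlib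

open MeasureTheory Filter Topology

noncomputable section

namespace MixedOP

/-! ### Linear functionals, moment matrices and mixed multiple orthogonal polynomials -/

/-- A `q × p` matrix of linear functionals on functions of a complex variable. A matrix of
measures on the real line acts through integration, see `ofMeasures`; a Dirac delta (or a
derivative of one) at a complex point acts through evaluation (of a derivative). -/
abbrev Functional (q p : ℕ) : Type := Fin q → Fin p → (ℂ → ℂ) → ℂ

/-- The integral of a complex function with respect to a complex measure on the real line. -/
def cint (μ : ComplexMeasure ℝ) (f : ℝ → ℂ) : ℂ :=
  VectorMeasure.integral μ f (ContinuousLinearMap.mul ℝ ℂ)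

/-- The functional `f ↦ ∫ f dμ_{b,a}` given by a matrix of measures. -/
def ofMeasures {q p : ℕ} (μ : Fin q → Fin p → ComplexMeasure ℝ) : Functional q p :=
  fun b a f => cint (μ b a) (fun t => f (t : ℂ))

/-- The moment matrix `∫ X_{[q]}(x) dμ(x) X_{[p]}ᵀ(x)`, where
`X_{[r]}(x) = (I_r, x I_r, x² I_r, …)ᵀ`: row `m` of `X_{[r]}(x)` is `x ^ (m / r)` times the
unit row vector number `m % r`. -/
def momentMatrix {q p : ℕ} [NeZero q] [NeZero p] (L : Functional q p) (m n : ℕ) : ℂ :=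
  L (Fin.ofNat q m) (Fin.ofNat p n) (fun t => t ^ (m / q) * t ^ (n / p))

/-- A semi-infinite lower unitriangular matrix. -/
def LowerUnitriangular (S : ℕ → ℕ → ℂ) : Prop :=
  (∀ m, S m m = 1) ∧ ∀ m j, m < j → S m j = 0

/-- The Gauss–Borel (`LU`) factorization `Mom = S⁻¹ H S̄⁻ᵀ`, written as `S Mom S̄ᵀ = H`, with
`S`, `S̄` lower unitriangular and `H` diagonal and invertible. (Rows of `S` and `S̄` have only
finitely many nonzero entries, so that the products are finite sums.) -/
structure IsGaussBorel (Mom S : ℕ → ℕ → ℂ) (H : ℕ → ℂ) (Sbar : ℕ → ℕ → ℂ) : Prop where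
  left : LowerUnitriangular S
  right : LowerUnitriangular Sbar
  diag : ∀ m, H m ≠ 0
  eq : ∀ m n, ∑ i ∈ Finset.range (m + 1), ∑ j ∈ Finset.range (n + 1),
    S m i * Mom i j * Sbar n j = if m = n then H m else 0

/-- `B_n^{(b)}`: the entries of `B(x) = S X_{[q]}(x)`. -/
def polyB {q : ℕ} [NeZero q] (S : ℕ → ℕ → ℂ) (n : ℕ) (b : Fin q) : Polynomial ℂ :=
  ∑ j ∈ Finset.range (n + 1),
    if Fin.ofNat q j = b then Polynomial.monomial (j / q) (S n j) else 0

/-- `A_n^{(a)}`: the entries of `A(x) = X_{[p]}ᵀ(x) S̄ᵀ H⁻¹`. -/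
def polyA {p : ℕ} [NeZero p] (Sbar : ℕ → ℕ → ℂ) (H : ℕ → ℂ) (n : ℕ) (a : Fin p) :
    Polynomial ℂ :=
  ∑ j ∈ Finset.range (n + 1),
    if Fin.ofNat p j = a then Polynomial.monomial (j / p) (Sbar n j / H n) else 0

/-- The Cauchy transform `D_n^{(a)}(w) = ∑_b ∫ B_n^{(b)}(x) dμ_{b,a}(x) / (w - x)`. -/
def cauchyD {q p : ℕ} (μ : Fin q → Fin p → ComplexMeasure ℝ) (B : ℕ → Fin q → Polynomial ℂ)
    (n : ℕ) (a : Fin p) (w : ℂ) : ℂ :=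
  ∑ b, cint (μ b a) (fun t => (B n b).eval (t : ℂ) / (w - (t : ℂ)))

/-! ### Matrix polynomials and Jordan chains -/

/-- `R = ∑_{l ≤ N} R_l x^l` with `R_N = [0, I_{p-r}; 0, 0]` and the lower left `r × r` block of
`R_{N-1}` equal to `I_r`. -/
structure IsNormalized {p : ℕ} (N r : ℕ) (R : Matrix (Fin p) (Fin p) (Polynomial ℂ)) :
    Prop where
  degree_le : ∀ a c, (R a c).natDegree ≤ N
  leading : ∀ a c : Fin p, (R a c).coeff N = if c.val = a.val + r then 1 else 0
  subleading : ∀ a c : Fin p, p ≤ a.val + r → c.val < r →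
    (R a c).coeff (N - 1) = if a.val + r = c.val + p then 1 else 0

/-- The `l`-th derivative of the matrix polynomial `R`, evaluated at `w`. -/
def evalDeriv {p : ℕ} (R : Matrix (Fin p) (Fin p) (Polynomial ℂ)) (l : ℕ) (w : ℂ) :
    Matrix (Fin p) (Fin p) ℂ :=
  R.map (fun P => (Polynomial.derivative^[l] P).eval w)

/-- `v 0, …, v (len - 1)` is a left Jordan chain of `R` at `w`. -/
def IsLeftChain {p : ℕ} (R : Matrix (Fin p) (Fin p) (Polynomial ℂ)) (w : ℂ) (len : ℕ)
    (v : ℕ → Fin p → ℂ) : Prop :=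
  ∀ k < len, ∑ l ∈ Finset.range (k + 1),
    (1 / (l.factorial : ℂ)) • Matrix.vecMul (v (k - l)) (evalDeriv R l w) = 0

/-- `v 0, …, v (len - 1)` is a right Jordan chain of `R` at `w`. -/
def IsRightChain {p : ℕ} (R : Matrix (Fin p) (Fin p) (Polynomial ℂ)) (w : ℂ) (len : ℕ)
    (v : ℕ → Fin p → ℂ) : Prop :=
  ∀ k < len, ∑ l ∈ Finset.range (k + 1),
    (1 / (l.factorial : ℂ)) • Matrix.mulVec (evalDeriv R l w) (v (k - l)) = 0

/-- Points `x_1, …, x_M`; at `x_i` there are `s_i` left and `s_i` right chains of vectors, the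
`j`-th ones of length `κ_{i,j}`. (Only the entries `v 0, …, v (κ_{i,j} - 1)` are used.) -/
structure ChainData (p : ℕ) where
  /-- the number `M` of points -/
  num : ℕ
  /-- the points `x_i` -/
  pt : Fin num → ℂ
  /-- the numbers `s_i` of chains -/
  chains : Fin num → ℕ
  /-- the lengths `κ_{i,j}` -/
  len : (i : Fin num) → Fin (chains i) → ℕ
  /-- the left vectors `v^L_{i,j;k}` -/
  vL : (i : Fin num) → Fin (chains i) → ℕ → Fin p → ℂ
  /-- the right vectors `v^R_{i,j;k}` -/
  vR : (i : Fin num) → Fin (chains i) → ℕ → Fin p → ℂ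

/-- The points are the distinct eigenvalues of `R` (the zeros of `det R`), and the vectors form
a left and a right canonical set of Jordan chains at each of them. -/
structure ChainData.IsCanonical {p : ℕ} (J : ChainData p)
    (R : Matrix (Fin p) (Fin p) (Polynomial ℂ)) : Prop where
  injective : Function.Injective J.pt
  eigenvalue : ∀ w : ℂ, R.det.eval w = 0 ↔ ∃ i, J.pt i = w
  len_pos : ∀ i j, 0 < J.len i j
  sum_len : ∀ i, ∑ j, J.len i j = R.det.rootMultiplicity (J.pt i)
  leftChain : ∀ i j, IsLeftChain R (J.pt i) (J.len i j) (J.vL i j)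
  rightChain : ∀ i j, IsRightChain R (J.pt i) (J.len i j) (J.vR i j)
  leftIndep : ∀ i, LinearIndependent ℂ (fun j => J.vL i j 0)
  rightIndep : ∀ i, LinearIndependent ℂ (fun j => J.vR i j 0)

/-- The total number `∑_{i,j} κ_{i,j}` of vectors in the chains. -/
def ChainData.size {p : ℕ} (J : ChainData p) : ℕ := ∑ i, ∑ j, J.len i j

/-- The lexicographic enumeration of the triples `(i, j, k)` with `k < κ_{i,j}`. -/
def ChainData.idx {p : ℕ} (J : ChainData p) :
    Fin J.size ≃ (i : Fin J.num) × (j : Fin (J.chains i)) × Fin (J.len i j) :=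
  ((Equiv.sigmaCongrRight fun _ => finSigmaFinEquiv).trans finSigmaFinEquiv).symm

/-! ### The Geronimus perturbation -/

/-- The action `⟨δ^{(l)}(t - w), g(t)⟩ = (-1)^l g^{(l)}(w)`. -/
def diracDeriv (l : ℕ) (w : ℂ) (g : ℂ → ℂ) : ℂ := (-1) ^ l * iteratedDeriv l g w

/-- Vector functions `ξ_{i,j,k}` with `q` components. -/
abbrev MassFunctions {p : ℕ} (J : ChainData p) (q : ℕ) : Type :=
  (i : Fin J.num) → Fin (J.chains i) → ℕ → ℂ → Fin q → ℂ

/-- The perturbed matrix of (generalized) measures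
`dμ(x) R(x)⁻¹ + ∑_{i,j,k} ξ_{i,j,k}(x) ∑_{l ≤ k} ((-1)^l / l!) v^L_{i,j;k-l} δ^{(l)}(x - x_i)`. -/
def perturbed {q p : ℕ} (μ : Fin q → Fin p → ComplexMeasure ℝ)
    (R : Matrix (Fin p) (Fin p) (Polynomial ℂ)) (J : ChainData p) (ξ : MassFunctions J q) :
    Functional q p :=
  fun b a f =>
    (∑ c, cint (μ b c) (fun t => f (t : ℂ) * (evalDeriv R 0 (t : ℂ))⁻¹ c a)) +
    ∑ i, ∑ j, ∑ k ∈ Finset.range (J.len i j), ∑ l ∈ Finset.range (k + 1),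
      ((-1) ^ l / (l.factorial : ℂ)) * J.vL i j (k - l) a *
        diracDeriv l (J.pt i) (fun t => ξ i j k t b * f t)

/-! ### The ingredients of the Christoffel-type formulas -/

section Christoffel

variable {q p : ℕ} (μ : Fin q → Fin p → ComplexMeasure ℝ)
  (R : Matrix (Fin p) (Fin p) (Polynomial ℂ)) (J : ChainData p) (ξ : MassFunctions J q)
  (A : ℕ → Fin p → Polynomial ℂ) (B : ℕ → Fin q → Polynomial ℂ)

/-- The entries of `𝔻_n`: `∑_{l ≤ k} (1 / l!) D_n^{(l)}(x_i) v^R_{i,j;k-l}`. -/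
def blockD (n : ℕ) (i : Fin J.num) (j : Fin (J.chains i)) (k : ℕ) : ℂ :=
  ∑ l ∈ Finset.range (k + 1), (1 / (l.factorial : ℂ)) *
    ∑ a, iteratedDeriv l (cauchyD μ B n a) (J.pt i) * J.vR i j (k - l) a

/-- Component `c` of the row vector
`∑_{j,k,l} ((-1)^l / l!) ∫ B_n(t) ξ_{i,j,k}(t) v^L_{i,j;k-l} δ^{(l)}(t - x_i) R(x) / (x - t) dt`. -/
def massCauchy (n : ℕ) (i : Fin J.num) (c : Fin p) (x : ℂ) : ℂ :=
  ∑ j, ∑ k ∈ Finset.range (J.len i j), ∑ l ∈ Finset.range (k + 1),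
    ((-1) ^ l / (l.factorial : ℂ)) *
      diracDeriv l (J.pt i) (fun t => (∑ b, (B n b).eval t * ξ i j k t b) / (x - t)) *
      ∑ a, J.vL i j (k - l) a * (R a c).eval x

/-- The expression under the limit that defines `𝕎_n`: the right Jordan chain operator
`∑_{l ≤ k} (1 / l!) (d/dx)^l ⬝ v^R_{i,j;k-l}` applied to `massCauchy`. -/
def preW (n : ℕ) (i : Fin J.num) (j : Fin (J.chains i)) (k : ℕ) (x : ℂ) : ℂ :=
  ∑ l ∈ Finset.range (k + 1), (1 / (l.factorial : ℂ)) *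
    ∑ c, iteratedDeriv l (massCauchy R J ξ B n i c) x * J.vR i j (k - l) c

/-- The entries of `𝕎_n`: the limits of `preW` as `x → x_i`. -/
def blockW (n : ℕ) (i : Fin J.num) (j : Fin (J.chains i)) (k : ℕ) : ℂ :=
  limUnder (𝓝[≠] (J.pt i)) (preW R J ξ B n i j k)

/-- The row `(𝔻_n^{(1)} - 𝕎_n^{(1)}, …, 𝔻_n^{(M)} - 𝕎_n^{(M)})`. -/
def rowDW (n : ℕ) (c : Fin J.size) : ℂ :=
  blockD μ J B n (J.idx c).1 (J.idx c).2.1 (J.idx c).2.2 -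
    blockW R J ξ B n (J.idx c).1 (J.idx c).2.1 (J.idx c).2.2

/-- The determinant `τ_n` of the rows `𝔻_m - 𝕎_m`, `m = n - size + 1, …, n`. -/
def tau (n : ℕ) : ℂ :=
  (Matrix.of fun ρ c : Fin J.size => rowDW μ R J ξ B (n + 1 - J.size + ρ) c).det

/-- Component `a` of `(𝕂^{[m],(1)}(x), …, 𝕂^{[m],(M)}(x))`, where
`𝕂^{[m],(i)}(x) = ∑_{ν ≤ m} A_ν(x) (𝔻_ν^{(i)} - 𝕎_ν^{(i)})`. -/
def rowK (m : ℕ) (a : Fin p) (x : ℂ) (c : Fin J.size) : ℂ :=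
  ∑ ν ∈ Finset.range (m + 1), (A ν a).eval x * rowDW μ R J ξ B ν c

/-- Component `a` of the pole vectors `(ℙ^{(1)}(x), …, ℙ^{(M)}(x))`: the column `(i, j, k)` is
`∑_{l ≤ k} (1 / l!) (d/dy)^l [1 / (x - y)]_{y = x_i} v^R_{i,j;k-l}
  = ∑_{l ≤ k} v^R_{i,j;k-l} / (x - x_i)^{l+1}`. -/
def rowP (a : Fin p) (x : ℂ) (c : Fin J.size) : ℂ :=
  ∑ l ∈ Finset.range ((J.idx c).2.2.val + 1),
    J.vR (J.idx c).1 (J.idx c).2.1 ((J.idx c).2.2 - l) a / (x - J.pt (J.idx c).1) ^ (l + 1)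

/-- The determinant with rows `𝔻_m - 𝕎_m`, `m = n - size + 1, …, n - 1`, and last row
component `a` of `𝕂^{[n-M]}(x) + ℙ(x)`. -/
def detA (n : ℕ) (a : Fin p) (x : ℂ) : ℂ :=
  (Matrix.of fun ρ c : Fin J.size =>
    if ρ.val + 1 = J.size then rowK μ R J ξ A B (n - J.num) a x c + rowP J a x c
    else rowDW μ R J ξ B (n + 1 - J.size + ρ) c).det

/-- The determinant with rows `(𝔻_m - 𝕎_m, B_m^{(b)}(x))`, `m = n - size, …, n`. -/
def detB (n : ℕ) (b : Fin q) (x : ℂ) : ℂ :=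
  (Matrix.of fun ρ : Fin (J.size + 1) =>
    (Fin.snoc (rowDW μ R J ξ B (n - J.size + ρ)) ((B (n - J.size + ρ) b).eval x) :
      Fin (J.size + 1) → ℂ)).det

end Christoffel

end MixedOP

end

open MeasureTheory Filter Topology

noncomputable section

namespace MixedOP

/-! ### Flags and biorthogonal sequences -/

section Flag

variable {U V : Type*} [AddCommGroup U] [Module ℂ U] [AddCommGroup V] [Module ℂ V]

/-! Let β be the bilinear form of dμ̌ on vectors of polynomials, T multiplication of columns by R,
and s = Np - r. The masses are built from left Jordan chains, so they annihilate multiples of R and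
dμ̌ R = dμ. Hence β(B_i, T A_j) = δ_ij, while β(B̌_i, Ǎ_j) = δ_ij (`pairing_mulColumn`,
`IsGaussBorel.biorth`). All these sequences are triangular with respect to the standard bases, so
old and new ones have the same flags. The normalization of R makes T raise the flag by s, and s is
also deg det R, which is the number of chain vectors.

The pole vectors ℙ_c come from right chains, so Q_c = R ℙ_c is polynomial. The s vectors Q_c lie in
the first s steps of the flag and are independent modulo the range of T (`poleQuot_mem`,
`ChainData.IsCanonical.indep`). The analytic core is `rowDW_eq`: the entry c of 𝔼_n is -β(B_n, Q_c).
Here 𝔻 accounts for the part dμ R⁻¹ (Taylor expansion of the Cauchy transform, `blockD_eq`) and 𝕎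
for the masses (`sum_masses_poleQuot`). The latter rests on two facts about v R v' for a left chain
v and a right chain v': at a common point it can be divided from either side (`coeff_leftQuot_mul`),
and chains at different points do not interact (`dvd_taylor_rightQuot`).

The rest is linear algebra, collected in `IsConnected`. B̌_n is a combination of B_{n-s}, …, B_n
orthogonal to every Q_c. Ǎ_n is a combination of the Q_c and of T A_ν with ν ≤ n - s, fixed by its
pairings with B_0, …, B_n. A vector in the kernel of the matrix behind τ_n would put a combination
of the Q_c into the range of T, so τ_n ≠ 0. Cramer's rule turns these descriptions into the
determinants. -/

/-- The span of the first `n` vectors of a sequence. -/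
def flag (G : ℕ → U) (n : ℕ) : Submodule ℂ U := Submodule.span ℂ (G '' Set.Iio n)

lemma mem_flag (G : ℕ → U) {i n : ℕ} (h : i < n) : G i ∈ flag G n :=
  Submodule.subset_span ⟨i, h, rfl⟩

lemma flag_mono (G : ℕ → U) {m n : ℕ} (h : m ≤ n) : flag G m ≤ flag G n :=
  Submodule.span_mono (Set.image_mono (Set.Iio_subset_Iio h))

lemma flag_le {G : ℕ → U} {n : ℕ} {W : Submodule ℂ U} (h : ∀ i < n, G i ∈ W) : flag G n ≤ W :=
  Submodule.span_le.2 (by rintro _ ⟨i, hi, rfl⟩; exact h i hi)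

/-- One inclusion is immediate; for the other, the nonzero diagonal coefficient allows solving for
E_n by induction. -/
lemma flag_eq_of_triangular {G E : ℕ → U} (h : ∀ n, ∃ c : ℂ, c ≠ 0 ∧ G n - c • E n ∈ flag E n)
    (n : ℕ) : flag G n = flag E n := by
  have hGE : ∀ n, flag G n ≤ flag E n := fun n => flag_le fun i hi => by
    obtain ⟨c, -, hc⟩ := h i
    rw [← sub_add_cancel (G i) (c • E i)]
    exact add_mem (flag_mono E hi.le hc) (Submodule.smul_mem _ _ (mem_flag E hi))
  refine le_antisymm (hGE n) ?_
  induction n with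
  | zero => exact flag_le fun i hi => absurd hi (Nat.not_lt_zero i)
  | succ n ih =>
    refine flag_le fun i hi => ?_
    rcases Nat.lt_succ_iff_lt_or_eq.1 hi with hi | rfl
    · exact flag_mono G n.le_succ (ih (mem_flag E hi))
    · obtain ⟨c, hc0, hc⟩ := h i
      have : E i = c⁻¹ • (G i - (G i - c • E i)) := by
        rw [sub_sub_cancel, smul_smul, inv_mul_cancel₀ hc0, one_smul]
      rw [this]
      exact Submodule.smul_mem _ _ (sub_mem (mem_flag G i.lt_succ_self)
        (flag_mono G i.le_succ (ih hc)))

lemma expand_left {β : U →ₗ[ℂ] V →ₗ[ℂ] ℂ} {G : ℕ → U} {K : ℕ → V}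
    (h : ∀ i j, β (G i) (K j) = if i = j then 1 else 0) {n : ℕ} {u : U} (hu : u ∈ flag G n) :
    u = ∑ j ∈ Finset.range n, β u (K j) • G j := by
  induction hu using Submodule.span_induction with
  | mem x hx =>
    obtain ⟨i, hi, rfl⟩ := hx
    have hi' : i < n := hi
    simp [h, hi']
  | zero => simp
  | add x y _ _ hx hy =>
    nth_rewrite 1 [hx, hy]
    simp [add_smul, Finset.sum_add_distrib]
  | smul c x _ hx =>
    nth_rewrite 1 [hx]
    simp [Finset.smul_sum, smul_smul]

lemma expand_right {β : U →ₗ[ℂ] V →ₗ[ℂ] ℂ} {G : ℕ → U} {K : ℕ → V}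
    (h : ∀ i j, β (G i) (K j) = if i = j then 1 else 0) {n : ℕ} {v : V} (hv : v ∈ flag K n) :
    v = ∑ j ∈ Finset.range n, β (G j) v • K j :=
  expand_left (β := β.flip) (G := K) (K := G) (fun i j => by simp [h, eq_comm]) hv

lemma apply_eq_zero_left {β : U →ₗ[ℂ] V →ₗ[ℂ] ℂ} {G : ℕ → U} {n : ℕ} {v : V}
    (h : ∀ i < n, β (G i) v = 0) {u : U} (hu : u ∈ flag G n) : β u v = 0 := by
  have : flag G n ≤ LinearMap.ker (β.flip v) := flag_le fun i hi => by simpa using h i hi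
  simpa using this hu

lemma apply_eq_zero_right {β : U →ₗ[ℂ] V →ₗ[ℂ] ℂ} {K : ℕ → V} {n : ℕ} {u : U}
    (h : ∀ j < n, β u (K j) = 0) {v : V} (hv : v ∈ flag K n) : β u v = 0 :=
  apply_eq_zero_left (β := β.flip) h hv

/-- Two biorthogonal pairs of sequences with the same flags: `(B', A')` for the form `β`, and
`(B, A)` for the form `β(·, T ·)`, where `T` shifts the flags by `s` and the vectors `Q c` span a
complement of the range of `T`. -/
structure IsConnected (s : ℕ) (β : U →ₗ[ℂ] V →ₗ[ℂ] ℂ) (T : V →ₗ[ℂ] V) (B B' : ℕ → U)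
    (A A' : ℕ → V) (Q : Fin s → V) : Prop where
  flag_left : ∀ n, flag B' n = flag B n
  flag_right : ∀ n, flag A' n = flag A n
  monic : ∀ n, B' n - B n ∈ flag B n
  biorth : ∀ i j, β (B i) (T (A j)) = if i = j then 1 else 0
  biorth' : ∀ i j, β (B' i) (A' j) = if i = j then 1 else 0
  shift : ∀ n, T (A n) ∈ flag A (n + s + 1)
  mem : ∀ c, Q c ∈ flag A s
  indep : ∀ (α : Fin s → ℂ) (v : V), ∑ c, α c • Q c = T v → α = 0

namespace IsConnected

variable {s : ℕ} {β : U →ₗ[ℂ] V →ₗ[ℂ] ℂ} {T : V →ₗ[ℂ] V} {B B' : ℕ → U} {A A' : ℕ → V}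
  {Q : Fin s → V} (h : IsConnected s β T B B' A A' Q)

include h

/-- Nondegeneracy of β on each flag: B and B' have the same flags, so v also has zero pairing with
each B'_i, and these pairings are its coordinates in A'. -/
lemma eq_zero {n : ℕ} {v : V} (hv : v ∈ flag A n) (h0 : ∀ i < n, β (B i) v = 0) : v = 0 := by
  rw [expand_right h.biorth' (v := v) (n := n) (by rwa [h.flag_right])]
  refine Finset.sum_eq_zero fun j hj => ?_
  have hj' := Finset.mem_range.1 hj
  rw [apply_eq_zero_left h0, zero_smul]
  rw [← h.flag_left n]
  exact mem_flag _ hj'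

lemma left_formula {n : ℕ} (hn : s ≤ n) :
    ∃ ω : Fin (s + 1) → ℂ, ω (Fin.last s) = 1 ∧ B' n = ∑ ρ, ω ρ • B (n - s + ρ) ∧
      ∀ c, ∑ ρ, ω ρ * β (B (n - s + ρ)) (Q c) = 0 := by
  have hmem : B' n ∈ flag B (n + 1) := by
    rw [← h.flag_left]; exact mem_flag _ n.lt_succ_self
  -- The sequence dual to B under β is T A, so the coordinates of B'_n in B are β(B'_n, T A_j).
  have hexp := expand_left (β := β.compl₂ T) (K := A) (by simpa using h.biorth) hmem
  have horth : ∀ {v : V}, v ∈ flag A n → β (B' n) v = 0 := fun {v} hv => by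
    refine apply_eq_zero_right (K := A') (n := n) (fun j hj => ?_) (h.flag_right n ▸ hv)
    rw [h.biorth', if_neg hj.ne']
  have hB' : B' n = ∑ ρ : Fin (s + 1), β (B' n) (T (A (n - s + ρ))) • B (n - s + ρ) := by
    rw [Fin.sum_univ_eq_sum_range (fun ρ => β (B' n) (T (A (n - s + ρ))) • B (n - s + ρ)) (s + 1)]
    nth_rewrite 1 [hexp]
    -- For j < n - s the vector T A_j still lies in the first n steps of the flag, to which B'_n is
    -- orthogonal; only s + 1 terms survive.
    have hsplit : n + 1 = (n - s) + (s + 1) := by omega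
    rw [hsplit, Finset.sum_range_add]
    rw [Finset.sum_eq_zero, zero_add]
    · simp
    · intro j hj
      have hj' := Finset.mem_range.1 hj
      rw [LinearMap.compl₂_apply, horth (flag_mono A (by omega) (h.shift j)), zero_smul]
  refine ⟨fun ρ => β (B' n) (T (A (n - s + ρ))), ?_, hB', fun c => ?_⟩
  · have hz : β (B' n - B n) (T (A n)) = 0 := by
      refine apply_eq_zero_left (G := B) (fun i hi => ?_) (h.monic n)
      rw [h.biorth, if_neg hi.ne]
    have h1 : n - s + (Fin.last s : ℕ) = n := by simp; omega
    simp only [h1]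
    rw [map_sub, LinearMap.sub_apply, sub_eq_zero] at hz
    rw [hz, h.biorth, if_pos rfl]
  · have := horth (flag_mono A hn (h.mem c))
    rw [hB'] at this
    simpa using this

/-- A kernel vector α gives v = ∑ α_c Q_c orthogonal to B_m, …, B_{m+s-1}. Subtracting a suitable T
w with w in the first m steps also removes the pairings with B_0, …, B_{m-1}; the difference lies in
the first m + s steps, hence vanishes, and independence modulo the range of T gives α = 0. -/
lemma det_ne_zero (m : ℕ) :
    (Matrix.of fun ρ c : Fin s => -β (B (m + ρ)) (Q c)).det ≠ 0 := by
  rw [← isUnit_iff_ne_zero, ← Matrix.isUnit_iff_isUnit_det, ← Matrix.mulVec_injective_iff_isUnit,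
    ← Matrix.coe_mulVecLin, injective_iff_map_eq_zero']
  intro α
  refine ⟨fun hα => ?_, fun hα => by rw [hα, map_zero]⟩
  set v := ∑ c, α c • Q c with hv
  have hrow : ∀ ρ < s, β (B (m + ρ)) v = 0 := fun ρ hρ => by
    have := congrFun hα ⟨ρ, hρ⟩
    simp only [Matrix.mulVecLin_apply, Matrix.mulVec, dotProduct, Matrix.of_apply, neg_mul,
      Finset.sum_neg_distrib, Pi.zero_apply, neg_eq_zero] at this
    rw [hv, map_sum, ← this]
    exact Finset.sum_congr rfl fun c _ => by rw [map_smul, smul_eq_mul, mul_comm]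
  set w := ∑ ν ∈ Finset.range m, β (B ν) v • A ν with hw
  have hBw : ∀ i, β (B i) (T w) = if i < m then β (B i) v else 0 := fun i => by
    simp only [hw, map_sum, map_smul, h.biorth, smul_eq_mul, mul_ite, mul_one, mul_zero]
    simp
  have hvw : v - T w = 0 := by
    refine h.eq_zero (n := m + s) (sub_mem ?_ ?_) fun i hi => ?_
    · exact flag_mono A (Nat.le_add_left s m)
        (sum_mem fun c _ => Submodule.smul_mem _ _ (h.mem c))
    · rw [hw, map_sum]
      refine sum_mem fun ν hν => ?_
      rw [map_smul]
      exact Submodule.smul_mem _ _ (flag_mono A (by have := Finset.mem_range.1 hν; omega)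
        (h.shift ν))
    · rw [map_sub, hBw]
      by_cases him : i < m
      · rw [if_pos him, sub_self]
      · obtain ⟨ρ, rfl⟩ := Nat.exists_eq_add_of_le (not_lt.1 him)
        rw [if_neg him, hrow ρ (by omega), sub_zero]
  exact h.indep α w (sub_eq_zero.1 hvw)

/-- Both sides lie in the first n + 1 steps of the flag, so comparing pairings with B_0, …, B_n
suffices. The choice of α handles the last s of them; each T A_ν corrects exactly the pairing with
B_ν. -/
lemma right_formula {n : ℕ} (hs : 0 < s) (hn : s ≤ n + 1) {α : Fin s → ℂ}
    (hα : ∀ ρ : Fin s, ∑ c, -β (B (n + 1 - s + ρ)) (Q c) * α c =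
      if (ρ : ℕ) + 1 = s then -1 else 0) :
    A' n = ∑ c, α c • Q c +
      ∑ ν ∈ Finset.range (n + 1 - s), (∑ c, -β (B ν) (Q c) * α c) • T (A ν) := by
  -- B_i differs from B'_i by a combination of B'_j with j < i ≤ n, all orthogonal to A'_n.
  have hB'A' : ∀ i ≤ n, β (B i) (A' n) = if i = n then 1 else 0 := fun i hi => by
    have hlow : β (B' i - B i) (A' n) = 0 := by
      refine apply_eq_zero_left (G := B') (n := i) (fun j hj => ?_) (h.flag_left i ▸ h.monic i)
      rw [h.biorth', if_neg (by omega)]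
    rw [map_sub, LinearMap.sub_apply, sub_eq_zero] at hlow
    rw [← hlow, h.biorth']
  have hEα : ∀ i, β (B i) (∑ c, α c • Q c) = -∑ c, -β (B i) (Q c) * α c := fun i => by
    simp only [map_sum, map_smul, smul_eq_mul, neg_mul, Finset.sum_neg_distrib, neg_neg]
    exact Finset.sum_congr rfl fun c _ => mul_comm _ _
  rw [← sub_eq_zero]
  refine h.eq_zero (n := n + 1) (sub_mem ?_ (add_mem ?_ ?_)) fun i hi => ?_
  · rw [← h.flag_right]; exact mem_flag _ n.lt_succ_self
  · exact flag_mono A hn (sum_mem fun c _ => Submodule.smul_mem _ _ (h.mem c))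
  · refine sum_mem fun ν hν => Submodule.smul_mem _ _ (flag_mono A ?_ (h.shift ν))
    have := Finset.mem_range.1 hν; omega
  · rw [map_sub, map_add, hB'A' i (by omega), hEα]
    simp only [map_sum, map_smul, h.biorth, smul_eq_mul, mul_ite, mul_one, mul_zero]
    rw [Finset.sum_ite_eq]
    by_cases hi' : i < n + 1 - s
    · rw [if_pos (Finset.mem_range.2 hi'), if_neg (show ¬i = n by omega)]; ring
    · have h2 := hα ⟨i - (n + 1 - s), by omega⟩
      have h3 : n + 1 - s + (i - (n + 1 - s)) = i := by omega
      simp only [h3] at h2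
      rw [if_neg (show i ∉ Finset.range (n + 1 - s) by simpa using hi'), h2]
      by_cases hin : i = n
      · rw [if_pos hin, if_pos (by omega)]; ring
      · rw [if_neg hin, if_neg (by omega)]; ring

end IsConnected

end Flag

/-! ### Determinants -/

/-- Replacing the last row by the combination of all rows with weights ω does not change the
determinant, as the last weight is 1. The new row vanishes except in the last entry, and expansion
along it finishes. -/
lemma det_snoc {s : ℕ} (E : Fin (s + 1) → Fin s → ℂ) (b ω : Fin (s + 1) → ℂ)
    (h1 : ω (Fin.last s) = 1) (h : ∀ c, ∑ ρ, ω ρ * E ρ c = 0) :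
    (Matrix.of fun ρ => (Fin.snoc (E ρ) (b ρ) : Fin (s + 1) → ℂ)).det =
      (Matrix.of fun ρ : Fin s => E ρ.castSucc).det * ∑ ρ, ω ρ * b ρ := by
  set M : Matrix (Fin (s + 1)) (Fin (s + 1)) ℂ :=
    Matrix.of fun ρ => (Fin.snoc (E ρ) (b ρ) : Fin (s + 1) → ℂ) with hM
  have hrow : ∑ ρ, ω ρ • M ρ = Fin.snoc (0 : Fin s → ℂ) (∑ ρ, ω ρ * b ρ) := by
    ext c
    refine Fin.lastCases ?_ (fun c => ?_) c
    · simp [hM]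
    · simpa [hM] using h c
  have hdet := Matrix.det_updateRow_sum M (Fin.last s) ω
  rw [h1, one_smul, hrow] at hdet
  rw [← hdet, Matrix.det_succ_row _ (Fin.last s), Finset.sum_eq_single (Fin.last s)]
  · rw [Matrix.updateRow_self, Fin.snoc_last]
    have hsub : ((M.updateRow (Fin.last s) (Fin.snoc (0 : Fin s → ℂ) (∑ ρ, ω ρ * b ρ))).submatrix
        (Fin.last s).succAbove (Fin.last s).succAbove) =
        Matrix.of fun ρ : Fin s => E ρ.castSucc := by
      ext ρ c
      simp [hM]
    rw [hsub, ← two_mul, pow_mul]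
    simp [mul_comm]
  · intro c _ hc
    obtain ⟨c, rfl⟩ := Fin.exists_castSucc_eq.2 hc
    simp [Matrix.updateRow_self]
  · simp

/-- Cramer's rule: writing y = ∑ γ_ρ E_ρ, the determinant is scaled by γ_ρ₀, and pairing with α
reads off -γ_ρ₀. -/
lemma det_updateRow_eq {ι : Type*} [Fintype ι] [DecidableEq ι] {E : Matrix ι ι ℂ} (hE : E.det ≠ 0)
    (ρ₀ : ι) {α : ι → ℂ} (hα : E.mulVec α = -Pi.single ρ₀ 1) (y : ι → ℂ) :
    (E.updateRow ρ₀ y).det = -(y ⬝ᵥ α) * E.det := by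
  set γ := Matrix.vecMul y E⁻¹ with hγ
  have hy : Matrix.vecMul γ E = y := by
    rw [hγ, Matrix.vecMul_vecMul, Matrix.nonsing_inv_mul _ (isUnit_iff_ne_zero.2 hE),
      Matrix.vecMul_one]
  have hsum : y = ∑ ρ, γ ρ • E ρ := by rw [← hy, Matrix.vecMul_eq_sum]
  have hdot : y ⬝ᵥ α = -γ ρ₀ := by
    rw [← hy, ← Matrix.dotProduct_mulVec, hα]; simp
  rw [hdot, neg_neg, hsum, Matrix.det_updateRow_sum, smul_eq_mul]

/-! ### The standard basis of vectors of polynomials -/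

/-- The transposes of the rows of `X_{[p]}`. -/
def stdVec (p : ℕ) [NeZero p] (n : ℕ) : Fin p → Polynomial ℂ :=
  Pi.single (Fin.ofNat p n) (Polynomial.X ^ (n / p))

section Std

variable {p q : ℕ} [NeZero p] [NeZero q]

lemma coeff_stdVec (n : ℕ) (a : Fin p) (k : ℕ) :
    (stdVec p n a).coeff k = if n = k * p + a then 1 else 0 := by
  have hp : 0 < p := Nat.pos_of_ne_zero (NeZero.ne p)
  have hiff : n = k * p + a ↔ a = Fin.ofNat p n ∧ k = n / p := by
    constructor
    · rintro rfl
      refine ⟨Fin.ext ?_, ?_⟩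
      · simp [Fin.ofNat, Nat.mod_eq_of_lt a.2]
      · rw [mul_comm, Nat.mul_add_div hp, Nat.div_eq_of_lt a.2, add_zero]
    · rintro ⟨rfl, rfl⟩
      simp only [Fin.ofNat]
      rw [mul_comm]; exact (Nat.div_add_mod n p).symm
  by_cases ha : a = Fin.ofNat p n
  · subst ha
    simp only [stdVec, Pi.single_eq_same, Polynomial.coeff_X_pow, hiff, true_and]
  · rw [stdVec, Pi.single_eq_of_ne ha, Polynomial.coeff_zero, if_neg (fun h => ha (hiff.1 h).1)]

/-- The monomial x^k in component a has position k p + a in the standard sequence, so flag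
membership becomes a bound on positions. -/
lemma mem_flag_stdVec {n : ℕ} {w : Fin p → Polynomial ℂ}
    (h : ∀ (a : Fin p) (k : ℕ), n ≤ k * p + a → (w a).coeff k = 0) : w ∈ flag (stdVec p) n := by
  have hw : w = ∑ j ∈ Finset.range n, (w (Fin.ofNat p j)).coeff (j / p) • stdVec p j := by
    ext a k
    simp only [Finset.sum_apply, Pi.smul_apply, Polynomial.finsetSum_coeff, Polynomial.coeff_smul,
      coeff_stdVec, smul_eq_mul, mul_ite, mul_one, mul_zero, Finset.sum_ite_eq', Finset.mem_range]
    split_ifs with hn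
    · have hp : 0 < p := Nat.pos_of_ne_zero (NeZero.ne p)
      have h1 : Fin.ofNat p (k * p + a) = a := by
        ext; simp [Fin.ofNat, Nat.mod_eq_of_lt a.2]
      have h2 : (k * p + a) / p = k := by
        rw [mul_comm, Nat.mul_add_div hp, Nat.div_eq_of_lt a.2, add_zero]
      rw [h1, h2]
    · exact h a k (not_lt.1 hn)
  rw [hw]
  exact sum_mem fun j hj => Submodule.smul_mem _ _ (mem_flag _ (Finset.mem_range.1 hj))

lemma polyB_eq_sum (S : ℕ → ℕ → ℂ) (n : ℕ) :
    polyB (q := q) S n = ∑ j ∈ Finset.range (n + 1), S n j • stdVec q j := by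
  ext b : 1
  simp only [polyB, Finset.sum_apply, Pi.smul_apply]
  refine Finset.sum_congr rfl fun j _ => ?_
  split_ifs with h
  · subst h
    rw [stdVec, Pi.single_eq_same, ← Polynomial.C_mul_X_pow_eq_monomial, Polynomial.smul_eq_C_mul]
  · rw [stdVec, Pi.single_eq_of_ne (Ne.symm h), smul_zero]

lemma polyA_eq_sum (Sbar : ℕ → ℕ → ℂ) (H : ℕ → ℂ) (n : ℕ) :
    polyA (p := p) Sbar H n = ∑ j ∈ Finset.range (n + 1), (Sbar n j / H n) • stdVec p j :=
  polyB_eq_sum (fun n j => Sbar n j / H n) n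

/-- The bilinear form on vectors of polynomials given by a matrix of functionals. -/
def pairing (L : Fin q → Fin p → Polynomial ℂ →ₗ[ℂ] ℂ) :
    (Fin q → Polynomial ℂ) →ₗ[ℂ] (Fin p → Polynomial ℂ) →ₗ[ℂ] ℂ :=
  LinearMap.mk₂ ℂ (fun u w => ∑ b, ∑ a, L b a (u b * w a))
    (fun u u' w => by simp [add_mul, Finset.sum_add_distrib])
    (fun c u w => by simp [Finset.mul_sum])
    (fun u w w' => by simp [mul_add, Finset.sum_add_distrib])
    (fun c u w => by simp [Finset.mul_sum])

omit [NeZero p] [NeZero q] in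
lemma pairing_apply (L : Fin q → Fin p → Polynomial ℂ →ₗ[ℂ] ℂ) (u : Fin q → Polynomial ℂ)
    (w : Fin p → Polynomial ℂ) : pairing L u w = ∑ b, ∑ a, L b a (u b * w a) := rfl

lemma pairing_stdVec (L : Fin q → Fin p → Polynomial ℂ →ₗ[ℂ] ℂ) (m n : ℕ) :
    pairing L (stdVec q m) (stdVec p n) =
      L (Fin.ofNat q m) (Fin.ofNat p n) (Polynomial.X ^ (m / q) * Polynomial.X ^ (n / p)) := by
  rw [pairing_apply, Finset.sum_eq_single (Fin.ofNat q m), Finset.sum_eq_single (Fin.ofNat p n)]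
  · simp [stdVec]
  · intro a _ ha; simp only [stdVec, Pi.single_eq_of_ne ha, mul_zero, map_zero]
  · simp
  · intro b _ hb
    exact Finset.sum_eq_zero fun a _ => by
      simp only [stdVec, Pi.single_eq_of_ne hb, zero_mul, map_zero]
  · simp

variable {L : Fin q → Fin p → Polynomial ℂ →ₗ[ℂ] ℂ} {S Sbar : ℕ → ℕ → ℂ} {H : ℕ → ℂ}

lemma LowerUnitriangular.sub_mem {S : ℕ → ℕ → ℂ} (h : LowerUnitriangular S) (n : ℕ) :
    polyB (q := q) S n - stdVec q n ∈ flag (stdVec q) n := by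
  rw [polyB_eq_sum, Finset.sum_range_succ, h.1, one_smul, add_sub_cancel_right]
  exact sum_mem fun j hj => Submodule.smul_mem _ _ (mem_flag _ (Finset.mem_range.1 hj))

lemma LowerUnitriangular.flag_polyB {S : ℕ → ℕ → ℂ} (h : LowerUnitriangular S) (n : ℕ) :
    flag (polyB (q := q) S) n = flag (stdVec q) n :=
  flag_eq_of_triangular (fun n => ⟨1, one_ne_zero, by simpa using h.sub_mem n⟩) n

lemma flag_polyA {S : ℕ → ℕ → ℂ} (h : LowerUnitriangular S) {H : ℕ → ℂ} (hH : ∀ n, H n ≠ 0)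
    (n : ℕ) : flag (polyA (p := p) S H) n = flag (stdVec p) n := by
  refine flag_eq_of_triangular (fun n => ⟨1 / H n, one_div_ne_zero (hH n), ?_⟩) n
  rw [polyA_eq_sum, Finset.sum_range_succ, h.1, add_sub_cancel_right]
  exact sum_mem fun j hj => Submodule.smul_mem _ _ (mem_flag _ (Finset.mem_range.1 hj))

lemma IsGaussBorel.biorth
    (h : IsGaussBorel (fun m n => L (Fin.ofNat q m) (Fin.ofNat p n)
      (Polynomial.X ^ (m / q) * Polynomial.X ^ (n / p))) S H Sbar) (m n : ℕ) :
    pairing L (polyB S m) (polyA Sbar H n) = if m = n then 1 else 0 := by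
  have h1 := h.eq m n
  rw [polyB_eq_sum, polyA_eq_sum]
  simp only [map_sum, map_smul, LinearMap.sum_apply, LinearMap.smul_apply, pairing_stdVec,
    smul_eq_mul]
  have h2 : (if m = n then 1 else 0 : ℂ) = (if m = n then H m else 0) / H n := by
    split_ifs with hmn
    · subst hmn; rw [div_self (h.diag m)]
    · rw [zero_div]
  rw [h2, ← h1, Finset.sum_comm, Finset.sum_div]
  refine Finset.sum_congr rfl fun i _ => ?_
  rw [Finset.sum_div, Finset.mul_sum]
  exact Finset.sum_congr rfl fun j _ => by ring

end Std

/-! ### Normalized matrix polynomials -/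

section Normalized

lemma coeff_prod_of_natDegree_le' {ι : Type*} (t : Finset ι) (f : ι → Polynomial ℂ) (d : ι → ℕ)
    (h : ∀ i ∈ t, (f i).natDegree ≤ d i) :
    (∏ i ∈ t, f i).coeff (∑ i ∈ t, d i) = ∏ i ∈ t, (f i).coeff (d i) := by
  classical
  induction t using Finset.induction_on with
  | empty => simp
  | insert i t hi ih =>
    have ht : ∀ j ∈ t, (f j).natDegree ≤ d j := fun j hj => h j (Finset.mem_insert_of_mem hj)
    rw [Finset.prod_insert hi, Finset.sum_insert hi, Finset.prod_insert hi,
      Polynomial.coeff_mul_add_eq_of_natDegree_le (h i (Finset.mem_insert_self i t))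
        ((Polynomial.natDegree_prod_le _ _).trans (Finset.sum_le_sum ht)), ih ht]

lemma natDegree_det_le_sum {ι : Type*} [Fintype ι] [DecidableEq ι]
    (M : Matrix ι ι (Polynomial ℂ)) (d : ι → ℕ) (h : ∀ i j, (M i j).natDegree ≤ d i) :
    M.det.natDegree ≤ ∑ i, d i := by
  -- The Leibniz formula runs through the columns; transposing lets it use bounds that depend on the
  -- row.
  rw [← Matrix.det_transpose, Matrix.det_apply]
  refine Polynomial.natDegree_sum_le_of_forall_le _ _ fun σ _ => ?_
  refine (Polynomial.natDegree_smul_le _ _).trans ?_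
  exact (Polynomial.natDegree_prod_le _ _).trans (Finset.sum_le_sum fun i _ => h _ _)

lemma coeff_det_sum {ι : Type*} [Fintype ι] [DecidableEq ι]
    (M : Matrix ι ι (Polynomial ℂ)) (d : ι → ℕ) (h : ∀ i j, (M i j).natDegree ≤ d i) :
    M.det.coeff (∑ i, d i) = (Matrix.of fun i j => (M i j).coeff (d i)).det := by
  rw [← Matrix.det_transpose, ← Matrix.det_transpose (Matrix.of _), Matrix.det_apply,
    Matrix.det_apply, Polynomial.finsetSum_coeff]
  refine Finset.sum_congr rfl fun σ _ => ?_
  rw [Polynomial.coeff_smul]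
  congr 1
  exact coeff_prod_of_natDegree_le' _ _ _ fun i _ => h _ _

variable {p N r : ℕ} {R : Matrix (Fin p) (Fin p) (Polynomial ℂ)}

/-- The two identity blocks are arranged so that the last nonzero position k p + a in column c of R
is c + N p - r, whether it comes from R_N (c ≥ r) or from R_{N-1} (c < r). This is why R shifts the
standard flag by N p - r. -/
lemma IsNormalized.coeff_eq_zero (hR : IsNormalized N r R) (hN : 1 ≤ N) (hr : r < p) {a c : Fin p}
    {k : ℕ} (h : c + N * p < k * p + a + r) : (R a c).coeff k = 0 := by
  have ha := a.2
  have hc := c.2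
  rcases lt_trichotomy k N with hk | rfl | hk
  · obtain ⟨d, rfl⟩ := Nat.exists_eq_add_of_lt hk
    rcases Nat.eq_zero_or_pos d with rfl | hd
    · have hac : p ≤ a.val + r := by
        simp only [add_mul, add_zero, one_mul] at h; omega
      have := hR.subleading a c hac (by simp only [add_mul, add_zero, one_mul] at h; omega)
      rw [show k + 0 + 1 - 1 = k by omega] at this
      rw [this, if_neg]
      simp only [add_mul, add_zero, one_mul] at h; omega
    · exfalso
      have : 1 * p ≤ d * p := Nat.mul_le_mul_right p hd
      simp only [add_mul, one_mul] at h this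
      omega
  · rw [hR.leading, if_neg (by omega)]
  · exact Polynomial.coeff_eq_zero_of_natDegree_lt ((hR.degree_le a c).trans_lt hk)

/-- The degrees of the rows of a normalized matrix polynomial. -/
def rowDegree {p : ℕ} (N r : ℕ) (a : Fin p) : ℕ := if a.val + r < p then N else N - 1

lemma IsNormalized.natDegree_le (hR : IsNormalized N r R) (a c : Fin p) :
    (R a c).natDegree ≤ rowDegree N r a := by
  have hc := c.2
  unfold rowDegree
  split_ifs with h
  · exact hR.degree_le a c
  · have h0 : (R a c).coeff N = 0 := by rw [hR.leading, if_neg (by omega)]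
    rw [Polynomial.natDegree_le_iff_coeff_eq_zero]
    intro k hk
    rcases (show N ≤ k by omega).eq_or_lt with rfl | hk
    · exact h0
    · exact Polynomial.coeff_eq_zero_of_natDegree_lt ((hR.degree_le a c).trans_lt hk)

lemma sum_rowDegree (hN : 1 ≤ N) (hr : r < p) : ∑ a : Fin p, rowDegree N r a = N * p - r := by
  obtain ⟨t, rfl⟩ := Nat.exists_eq_add_of_lt hr
  obtain ⟨N, rfl⟩ := Nat.exists_eq_add_of_le hN
  unfold rowDegree
  rw [Fin.sum_univ_eq_sum_range
    (fun a => if a + r < r + t + 1 then 1 + N else 1 + N - 1) (r + t + 1),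
    show r + t + 1 = (t + 1) + r by ring, Finset.sum_range_add]
  rw [Finset.sum_congr rfl (g := fun _ => 1 + N)
      (fun a ha => if_pos (by have := Finset.mem_range.1 ha; omega)),
    Finset.sum_congr (s₁ := Finset.range r) rfl (g := fun _ => N)
      (fun a ha => by rw [if_neg (by omega)]; omega)]
  simp only [Finset.sum_const, Finset.card_range, smul_eq_mul]
  refine (Nat.sub_eq_of_eq_add ?_).symm
  ring

lemma IsNormalized.natDegree_det [NeZero p] (hR : IsNormalized N r R) (hN : 1 ≤ N) (hr : r < p) :
    R.det.natDegree = N * p - r := by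
  rw [← sum_rowDegree hN hr]
  refine le_antisymm (natDegree_det_le_sum R _ hR.natDegree_le)
    (Polynomial.le_natDegree_of_ne_zero ?_)
  rw [coeff_det_sum R _ hR.natDegree_le]
  set E : Matrix (Fin p) (Fin p) ℂ := Matrix.of fun i j => (R i j).coeff (rowDegree N r i) with hE
  -- Shifting the columns cyclically by r makes the matrix of leading row coefficients lower
  -- unitriangular; the unspecified entries of R_{N-1} fall below the diagonal.
  set σ : Equiv.Perm (Fin p) := Equiv.addRight (⟨r, hr⟩ : Fin p) with hσ
  have hσv : ∀ a : Fin p, (σ a).val = if a.val + r < p then a.val + r else a.val + r - p := by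
    intro a
    have ha := a.2
    have : (σ a).val = (a.val + r) % p := by simp [hσ, Fin.val_add]
    rw [this]
    split_ifs with h
    · exact Nat.mod_eq_of_lt h
    · rw [Nat.mod_eq_sub_mod (not_lt.1 h), Nat.mod_eq_of_lt (by omega)]
  have hval : ∀ a c : Fin p, a ≤ c → E a (σ c) = if a = c then 1 else 0 := by
    intro a c hac
    have hac' : a.val ≤ c.val := hac
    have hc := c.2
    have hcσ := hσv c
    simp only [hE, Matrix.of_apply, rowDegree, Fin.ext_iff]
    by_cases ha : a.val + r < p
    · rw [if_pos ha, hR.leading, hcσ]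
      split_ifs <;> first | rfl | omega
    · rw [if_neg ha, hR.subleading _ _ (by omega) (by rw [hcσ]; split_ifs <;> omega), hcσ]
      split_ifs <;> first | rfl | omega
  have htri : (E.submatrix id σ).det = 1 := by
    rw [Matrix.det_of_isLowerTriangular]
    · exact Finset.prod_eq_one fun a _ => by simp [hval a a le_rfl]
    · intro a c hac
      have hac' : a < c := hac
      simp [hval a c hac'.le, hac'.ne]
  rw [Matrix.det_permute'] at htri
  intro h0
  rw [h0, mul_zero] at htri
  exact zero_ne_one htri

variable [NeZero p]

/-- Multiplication of a column vector by a matrix polynomial. -/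
def mulColumn (R : Matrix (Fin p) (Fin p) (Polynomial ℂ)) :
    (Fin p → Polynomial ℂ) →ₗ[ℂ] (Fin p → Polynomial ℂ) :=
  (Matrix.mulVecLin R).restrictScalars ℂ

omit [NeZero p] in
lemma mulColumn_apply (R : Matrix (Fin p) (Fin p) (Polynomial ℂ)) (w : Fin p → Polynomial ℂ)
    (a : Fin p) : mulColumn R w a = ∑ c, R a c * w c := rfl

lemma IsNormalized.mulColumn_stdVec_mem (hR : IsNormalized N r R) (hN : 1 ≤ N) (hr : r < p)
    (n : ℕ) : mulColumn R (stdVec p n) ∈ flag (stdVec p) (n + (N * p - r) + 1) := by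
  refine mem_flag_stdVec fun a k hk => ?_
  have hval : mulColumn R (stdVec p n) a = R a (Fin.ofNat p n) * Polynomial.X ^ (n / p) := by
    rw [mulColumn_apply, Finset.sum_eq_single (Fin.ofNat p n)]
    · simp [stdVec]
    · intro c _ hc; simp only [stdVec, Pi.single_eq_of_ne hc, mul_zero]
    · simp
  rw [hval, Polynomial.coeff_mul_X_pow']
  split_ifs with hle
  · refine hR.coeff_eq_zero hN hr ?_
    obtain ⟨d, rfl⟩ := Nat.exists_eq_add_of_le hle
    have h1 : (Fin.ofNat p n).val = n % p := rfl
    have h2 := Nat.mod_add_div n p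
    have h3 : p ≤ N * p := Nat.le_mul_of_pos_left p hN
    rw [h1, Nat.add_sub_cancel_left]
    rw [add_mul, mul_comm (n / p) p] at hk
    omega
  · rfl

lemma IsNormalized.mulColumn_mem (hR : IsNormalized N r R) (hN : 1 ≤ N) (hr : r < p) {n : ℕ}
    {w : Fin p → Polynomial ℂ} (hw : w ∈ flag (stdVec p) (n + 1)) :
    mulColumn R w ∈ flag (stdVec p) (n + (N * p - r) + 1) := by
  have : flag (stdVec p) (n + 1) ≤
      (flag (stdVec p) (n + (N * p - r) + 1)).comap (mulColumn R) := flag_le fun i hi =>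
    flag_mono _ (by omega) (hR.mulColumn_stdVec_mem hN hr i)
  exact this hw

end Normalized

/-! ### Integrals with respect to complex measures -/

section Cint

variable {ν : ComplexMeasure ℝ} {Δ : Set ℝ}

lemma cint_const_mul (c : ℂ) (f : ℝ → ℂ) : cint ν (fun t => c * f t) = c * cint ν f :=
  setToFun_smul _ (fun c s x => by
    simp [VectorMeasure.transpose, VectorMeasure.mapRange_apply, mul_left_comm]) c f

lemma cint_add {f g : ℝ → ℂ} (hf : ν.Integrable f) (hg : ν.Integrable g) :
    cint ν (fun t => f t + g t) = cint ν f + cint ν g :=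
  VectorMeasure.integral_fun_add hf hg

lemma cint_sum {ι : Type*} (s : Finset ι) {f : ι → ℝ → ℂ} (hf : ∀ i ∈ s, ν.Integrable (f i)) :
    cint ν (fun t => ∑ i ∈ s, f i t) = ∑ i ∈ s, cint ν (f i) :=
  VectorMeasure.integral_finsetSum s hf

lemma ae_mem (hsupp : ν.variation Δᶜ = 0) : ∀ᵐ t ∂ν.variation, t ∈ Δ := hsupp

lemma cint_congr (hsupp : ν.variation Δᶜ = 0) {f g : ℝ → ℂ} (h : ∀ t ∈ Δ, f t = g t) :
    cint ν f = cint ν g :=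
  VectorMeasure.integral_congr_ae (by filter_upwards [ae_mem hsupp] with t ht using h t ht)

/-- The bracket depends neither on K nor on g, so a geometric factor K yields convergence of series
of integrals. -/
lemma norm_cint_le (hsupp : ν.variation Δᶜ = 0) {f g : ℝ → ℂ} {K : ℝ} (hf : ν.Integrable f)
    (h : ∀ t ∈ Δ, ‖g t‖ ≤ K * ‖f t‖) :
    ‖cint ν g‖ ≤ K * (‖ContinuousLinearMap.mul ℝ ℂ‖ * ∫ t, ‖f t‖ ∂ν.variation) := by
  refine (VectorMeasure.norm_integral_le_integral_norm).trans ?_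
  rw [mul_left_comm, ← integral_const_mul K]
  refine mul_le_mul_of_nonneg_left ?_
    (ContinuousLinearMap.opNorm_nonneg (ContinuousLinearMap.mul ℝ ℂ))
  refine integral_mono_of_nonneg (Eventually.of_forall fun t => norm_nonneg _)
    (hf.norm.const_mul K) ?_
  filter_upwards [ae_mem hsupp] with t ht using h t ht

/-- A nonconstant polynomial tends to infinity in norm, so its norm attains a minimum on the closed
set Δ even if Δ is unbounded. -/
lemma exists_pos_le_norm_eval {P : Polynomial ℂ} (hP : 0 < P.degree) (hΔ : IsClosed Δ)
    (h : ∀ t ∈ Δ, P.eval (t : ℂ) ≠ 0) : ∃ δ > 0, ∀ t ∈ Δ, δ ≤ ‖P.eval (t : ℂ)‖ := by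
  rcases Δ.eq_empty_or_nonempty with rfl | ⟨t₀, ht₀⟩
  · exact ⟨1, one_pos, by simp⟩
  have hlim : Tendsto (fun t : ℝ => ‖P.eval (t : ℂ)‖) (cocompact ℝ) atTop :=
    P.tendsto_norm_atTop hP (by
      simpa only [Complex.norm_real] using tendsto_norm_cocompact_atTop (E := ℝ))
  have hcont : Continuous fun t : ℝ => ‖P.eval (t : ℂ)‖ :=
    (P.continuous.comp Complex.continuous_ofReal).norm
  obtain ⟨t₁, ht₁, hmin⟩ := hcont.continuousOn.exists_isMinOn' hΔ ht₀
    ((hlim.eventually_ge_atTop _).filter_mono inf_le_left)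
  exact ⟨_, norm_pos_iff.2 (h t₁ ht₁), fun t ht => hmin ht⟩

lemma integrable_eval (hmom : ∀ n : ℕ, ν.Integrable (fun t : ℝ => (t : ℂ) ^ n))
    (f : Polynomial ℂ) : ν.Integrable (fun t : ℝ => f.eval (t : ℂ)) := by
  simp_rw [Polynomial.eval_eq_sum_range]
  exact integrable_finsetSum _ fun i _ => (hmom i).const_mul _

lemma integrable_eval_div (hsupp : ν.variation Δᶜ = 0)
    (hmom : ∀ n : ℕ, ν.Integrable (fun t : ℝ => (t : ℂ) ^ n)) (hΔ : IsClosed Δ)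
    (f : Polynomial ℂ) {P : Polynomial ℂ} (hP : 0 < P.degree)
    (h : ∀ t ∈ Δ, P.eval (t : ℂ) ≠ 0) :
    ν.Integrable (fun t : ℝ => f.eval (t : ℂ) / P.eval (t : ℂ)) := by
  obtain ⟨δ, hδ, hle⟩ := exists_pos_le_norm_eval hP hΔ h
  refine Integrable.mono ((integrable_eval hmom f).norm.const_mul δ⁻¹) ?_ ?_
  · have hm : ∀ g : Polynomial ℂ, Measurable fun t : ℝ => g.eval (t : ℂ) := fun g =>
      (g.continuous.comp Complex.continuous_ofReal).measurable
    exact ((hm f).div (hm P)).aestronglyMeasurable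
  · filter_upwards [ae_mem hsupp] with t ht
    rw [norm_div, norm_mul, norm_norm, Real.norm_of_nonneg (inv_nonneg.2 hδ.le), div_eq_inv_mul]
    gcongr
    exact hle t ht

lemma iteratedDeriv_eq_of_hasSum {F : ℂ → ℂ} {z : ℂ} {c : ℕ → ℂ}
    (h : ∀ᶠ w in 𝓝 z, HasSum (fun n => (w - z) ^ n * c n) (F w)) (l : ℕ) :
    iteratedDeriv l F z = l.factorial * c l := by
  have hF : HasFPowerSeriesAt F (FormalMultilinearSeries.ofScalars ℂ c) z := by
    rw [hasFPowerSeriesAt_iff']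
    simpa [FormalMultilinearSeries.coeff_ofScalars] using h
  have h2 := hF.analyticAt.hasFPowerSeriesAt
  have h3 := congrArg (fun p => FormalMultilinearSeries.coeff p l)
    (hF.eq_formalMultilinearSeries h2)
  simp only [FormalMultilinearSeries.coeff_ofScalars] at h3
  rw [h3, mul_div_cancel₀ _ (Nat.cast_ne_zero.2 l.factorial_ne_zero)]

/-- Geometric expansion of 1/(w - t) in powers of (w - z)/(t - z). With δ the distance bound from z
to Δ, these ratios are at most 1/2 for w within δ/2 of z, and the explicit remainder is estimated
under the integral. -/
lemma hasSum_cint_cauchy (hsupp : ν.variation Δᶜ = 0)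
    (hmom : ∀ n : ℕ, ν.Integrable (fun t : ℝ => (t : ℂ) ^ n)) (hΔ : IsClosed Δ)
    (f : Polynomial ℂ) {z : ℂ} (hz : ∀ t ∈ Δ, (t : ℂ) ≠ z) :
    ∀ᶠ w in 𝓝 z, HasSum
      (fun n => (w - z) ^ n * -cint ν (fun t => f.eval (t : ℂ) / ((t : ℂ) - z) ^ (n + 1)))
      (cint ν (fun t => f.eval (t : ℂ) / (w - (t : ℂ)))) := by
  have hev : ∀ (y t : ℂ), (Polynomial.X - Polynomial.C y).eval t = t - y := by simp
  have hdeg : ∀ y : ℂ, 0 < (Polynomial.X - Polynomial.C y).degree := by simp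
  obtain ⟨δ, hδ, hle⟩ := exists_pos_le_norm_eval (hdeg z) hΔ
    (fun t ht => by rw [hev]; exact sub_ne_zero.2 (hz t ht))
  simp only [hev] at hle
  filter_upwards [Metric.ball_mem_nhds z (half_pos hδ)] with w hw
  rw [Metric.mem_ball, dist_eq_norm] at hw
  set C := ‖ContinuousLinearMap.mul ℝ ℂ‖ * ∫ t : ℝ, ‖f.eval (t : ℂ)‖ ∂ν.variation with hC
  have hC0 : 0 ≤ C := mul_nonneg (ContinuousLinearMap.opNorm_nonneg _) (integral_nonneg fun t => norm_nonneg _)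
  have hwt : ∀ t ∈ Δ, δ / 2 ≤ ‖w - (t : ℂ)‖ := fun t ht => by
    have h1 := hle t ht
    have h2 : ‖(t : ℂ) - z‖ ≤ ‖w - z‖ + ‖w - (t : ℂ)‖ := by
      have := norm_sub_le (w - z) (w - (t : ℂ))
      simpa using this
    linarith
  have hint : ∀ n : ℕ, ν.Integrable (fun t : ℝ => f.eval (t : ℂ) / ((t : ℂ) - z) ^ (n + 1)) := by
    intro n
    have := integrable_eval_div hsupp hmom hΔ f (P := (Polynomial.X - Polynomial.C z) ^ (n + 1))
      (by rw [Polynomial.degree_pow, Polynomial.degree_X_sub_C]; simp; positivity)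
      (fun t ht => by
        rw [Polynomial.eval_pow, hev]; exact pow_ne_zero _ (sub_ne_zero.2 (hz t ht)))
    simpa using this
  have hratio : ∀ t ∈ Δ, ‖(w - z) / ((t : ℂ) - z)‖ ≤ 1 / 2 := fun t ht => by
    have h1 := hle t ht
    rw [norm_div, div_le_iff₀ (hδ.trans_le h1)]
    linarith
  have hbound : ∀ n, ‖(w - z) ^ n *
      -cint ν (fun t => f.eval (t : ℂ) / ((t : ℂ) - z) ^ (n + 1))‖ ≤ (1 / 2) ^ n * (δ⁻¹ * C) := by
    intro n
    rw [mul_neg, norm_neg, ← cint_const_mul, ← mul_assoc]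
    refine norm_cint_le hsupp (integrable_eval hmom f) fun t ht => ?_
    have h1 : (w - z) ^ n * (f.eval (t : ℂ) / ((t : ℂ) - z) ^ (n + 1)) =
        ((w - z) / ((t : ℂ) - z)) ^ n * ((t : ℂ) - z)⁻¹ * f.eval (t : ℂ) := by
      rw [div_pow, pow_succ]; field_simp
    rw [h1, norm_mul, norm_mul, norm_pow, norm_inv]
    gcongr
    · exact hratio t ht
    · exact hle t ht
  have hsummable : Summable fun n => ‖(w - z) ^ n *
      -cint ν (fun t => f.eval (t : ℂ) / ((t : ℂ) - z) ^ (n + 1))‖ :=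
    Summable.of_nonneg_of_le (fun n => norm_nonneg _) hbound
      ((summable_geometric_of_lt_one (by norm_num) (by norm_num)).mul_right _)
  rw [hasSum_iff_tendsto_nat_of_summable_norm hsummable]
  have hwint : ν.Integrable (fun t : ℝ => f.eval (t : ℂ) / (w - (t : ℂ))) := by
    -- The sign is moved to the numerator so that the denominator is the monic polynomial t - w.
    have := integrable_eval_div hsupp hmom hΔ (-f) (P := Polynomial.X - Polynomial.C w) (hdeg w)
      (fun t ht => by
        rw [hev, ← norm_pos_iff, norm_sub_rev]
        exact (half_pos hδ).trans_le (hwt t ht))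
    refine this.congr (Eventually.of_forall fun t => ?_)
    simp only [hev, Polynomial.eval_neg]
    rw [← neg_sub w, neg_div_neg_eq]
  rw [tendsto_iff_norm_sub_tendsto_zero]
  refine squeeze_zero (g := fun n => (1 / 2 : ℝ) ^ n * ((δ / 2)⁻¹ * C))
    (fun n => norm_nonneg _) (fun n => ?_) ?_
  · have h1 : ∑ i ∈ Finset.range n, (w - z) ^ i *
        -cint ν (fun t => f.eval (t : ℂ) / ((t : ℂ) - z) ^ (i + 1)) -
        cint ν (fun t => f.eval (t : ℂ) / (w - (t : ℂ))) =
        -cint ν (fun t => ∑ i ∈ Finset.range n,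
          (w - z) ^ i * (f.eval (t : ℂ) / ((t : ℂ) - z) ^ (i + 1)) +
            f.eval (t : ℂ) / (w - (t : ℂ))) := by
      rw [cint_add (integrable_finsetSum _ fun i _ => (hint i).const_mul _) hwint, cint_sum _
        (fun i _ => (hint i).const_mul _)]
      simp only [cint_const_mul, mul_neg, Finset.sum_neg_distrib]
      ring
    rw [h1, norm_neg, ← mul_assoc]
    refine norm_cint_le hsupp (integrable_eval hmom f) fun t ht => ?_
    have ha : (t : ℂ) - z ≠ 0 := sub_ne_zero.2 (hz t ht)
    have hb : w - (t : ℂ) ≠ 0 := norm_pos_iff.1 ((half_pos hδ).trans_le (hwt t ht))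
    have h2 : ∑ i ∈ Finset.range n, (w - z) ^ i * (f.eval (t : ℂ) / ((t : ℂ) - z) ^ (i + 1)) +
        f.eval (t : ℂ) / (w - (t : ℂ)) =
        ((w - z) / ((t : ℂ) - z)) ^ n * (w - (t : ℂ))⁻¹ * f.eval (t : ℂ) := by
      clear h1
      induction n with
      | zero => simp [div_eq_inv_mul]
      | succ n ih =>
        rw [Finset.sum_range_succ, add_right_comm, ih, div_pow, div_pow]
        field_simp
        ring
    rw [h2, norm_mul, norm_mul, norm_pow, norm_inv]
    gcongr
    · exact hratio t ht
    · exact hwt t ht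
  · simpa using (tendsto_pow_atTop_nhds_zero_of_lt_one (r := (1 / 2 : ℝ)) (by norm_num)
      (by norm_num)).mul_const ((δ / 2)⁻¹ * C)

end Cint

lemma iteratedDeriv_cauchyD {p q : ℕ} {μ : Fin q → Fin p → ComplexMeasure ℝ} {Δ : Set ℝ}
    (hΔ : IsClosed Δ) (hsupp : ∀ b a, (μ b a).variation Δᶜ = 0)
    (hmom : ∀ b a, ∀ n : ℕ, (μ b a).Integrable (fun t : ℝ => (t : ℂ) ^ n))
    (B : ℕ → Fin q → Polynomial ℂ) (n : ℕ) (a : Fin p) {z : ℂ} (hz : ∀ t ∈ Δ, (t : ℂ) ≠ z)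
    (l : ℕ) :
    iteratedDeriv l (cauchyD μ B n a) z = -(l.factorial *
      ∑ b, cint (μ b a) (fun t => (B n b).eval (t : ℂ) / ((t : ℂ) - z) ^ (l + 1))) := by
  rw [← mul_neg, ← Finset.sum_neg_distrib]
  refine iteratedDeriv_eq_of_hasSum (c := fun l => ∑ b,
    -cint (μ b a) (fun t => (B n b).eval (t : ℂ) / ((t : ℂ) - z) ^ (l + 1))) ?_ l
  filter_upwards [eventually_all.2 fun b => hasSum_cint_cauchy (hsupp b a) (hmom b a) hΔ (B n b) hz]
    with w hw
  simp_rw [Finset.mul_sum]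
  exact hasSum_sum fun b _ => hw b

/-! ### Taylor coefficients -/

section Taylor

/-- The Taylor coefficient `g^{(l)}(w) / l!`. -/
def taylorCoeff (l : ℕ) (g : ℂ → ℂ) (w : ℂ) : ℂ := iteratedDeriv l g w / l.factorial

lemma coeff_mul_eq_sum_range (P Q : Polynomial ℂ) (d : ℕ) :
    (P * Q).coeff d = ∑ l ∈ Finset.range (d + 1), P.coeff l * Q.coeff (d - l) := by
  rw [Polynomial.coeff_mul,
    Finset.Nat.sum_antidiagonal_eq_sum_range_succ (fun i j => P.coeff i * Q.coeff j)]

lemma coeff_mul_eq_sum_range' (P Q : Polynomial ℂ) (d : ℕ) :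
    (P * Q).coeff d = ∑ l ∈ Finset.range (d + 1), Q.coeff l * P.coeff (d - l) := by
  rw [mul_comm, coeff_mul_eq_sum_range]

/-- Associativity of convolution. In the applications m is the order falling on ξB, the second index
the order falling on the other factor, and the third the index in the chain. -/
lemma sum_triangle (k : ℕ) (f : ℕ → ℕ → ℕ → ℂ) :
    ∑ l ∈ Finset.range (k + 1), ∑ m ∈ Finset.range (l + 1), f m (l - m) (k - l) =
      ∑ m ∈ Finset.range (k + 1), ∑ l ∈ Finset.range (k - m + 1), f m l (k - m - l) := by
  rw [Finset.sum_comm' (s' := fun m => Finset.Ico m (k + 1)) (t' := Finset.range (k + 1))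
    (fun l m => by simp only [Finset.mem_range, Finset.mem_Ico]; omega)]
  refine Finset.sum_congr rfl fun m hm => ?_
  have hm' := Finset.mem_range.1 hm
  rw [Finset.sum_Ico_eq_sum_range, show k + 1 - m = k - m + 1 by omega]
  refine Finset.sum_congr rfl fun l _ => ?_
  rw [Nat.add_sub_cancel_left, Nat.sub_sub]

lemma taylorCoeff_mul {l : ℕ} {f g : ℂ → ℂ} {w : ℂ} (hf : ContDiffAt ℂ l f w)
    (hg : ContDiffAt ℂ l g w) :
    taylorCoeff l (fun t => f t * g t) w =
      ∑ m ∈ Finset.range (l + 1), taylorCoeff m f w * taylorCoeff (l - m) g w := by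
  rw [taylorCoeff, iteratedDeriv_fun_mul hf hg, Finset.sum_div]
  refine Finset.sum_congr rfl fun m hm => ?_
  have hm' : m ≤ l := Nat.lt_succ_iff.1 (Finset.mem_range.1 hm)
  rw [taylorCoeff, taylorCoeff, Nat.cast_choose ℂ hm']
  have h1 : (l.factorial : ℂ) ≠ 0 := Nat.cast_ne_zero.2 l.factorial_ne_zero
  field_simp

lemma iteratedDeriv_eval (l : ℕ) (f : Polynomial ℂ) :
    iteratedDeriv l (fun t => f.eval t) = fun t => (Polynomial.derivative^[l] f).eval t := by
  induction l with
  | zero => simp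
  | succ l ih =>
    ext t
    rw [iteratedDeriv_succ, ih, Polynomial.deriv, Function.iterate_succ_apply']

lemma eval_iterate_derivative (l : ℕ) (f : Polynomial ℂ) (w : ℂ) :
    (Polynomial.derivative^[l] f).eval w = l.factorial * (Polynomial.taylor w f).coeff l := by
  rw [Polynomial.taylor_coeff, ← Polynomial.factorial_smul_hasseDeriv]
  simp

lemma taylorCoeff_eval (l : ℕ) (f : Polynomial ℂ) (w : ℂ) :
    taylorCoeff l (fun t => f.eval t) w = (Polynomial.taylor w f).coeff l := by
  simp only [taylorCoeff, iteratedDeriv_eval]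
  rw [eval_iterate_derivative,
    mul_div_cancel_left₀ _ (Nat.cast_ne_zero.2 l.factorial_ne_zero)]

lemma contDiffAt_eval {n : WithTop ℕ∞} (f : Polynomial ℂ) (w : ℂ) :
    ContDiffAt ℂ n (fun t => f.eval t) w := by
  simpa using (f.contDiff_aeval (𝕜 := ℂ) n).contDiffAt (x := w)

lemma taylorCoeff_sum {ι : Type*} (s : Finset ι) {l : ℕ} {f : ι → ℂ → ℂ} {w : ℂ}
    (hf : ∀ i ∈ s, ContDiffAt ℂ l (f i) w) :
    taylorCoeff l (fun t => ∑ i ∈ s, f i t) w = ∑ i ∈ s, taylorCoeff l (f i) w := by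
  rw [taylorCoeff, iteratedDeriv_fun_sum hf, Finset.sum_div]
  rfl

lemma taylorCoeff_cauchyKernel (l : ℕ) {x w : ℂ} (hx : x ≠ w) :
    taylorCoeff l (fun t => (x - t)⁻¹) w = ((x - w) ^ (l + 1))⁻¹ := by
  have hxw : x - w ≠ 0 := sub_ne_zero.2 hx
  rw [taylorCoeff, iteratedDeriv_eq_of_hasSum (c := fun l => ((x - w) ^ (l + 1))⁻¹),
    mul_div_cancel_left₀ _ (Nat.cast_ne_zero.2 l.factorial_ne_zero)]
  filter_upwards [Metric.ball_mem_nhds w (norm_pos_iff.2 hxw)] with t ht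
  rw [Metric.mem_ball, dist_eq_norm] at ht
  have hr : ‖(t - w) / (x - w)‖ < 1 := by
    rwa [norm_div, div_lt_one (norm_pos_iff.2 hxw)]
  have hxt : x - t ≠ 0 := fun h => by
    rw [sub_eq_zero] at h; subst h; exact lt_irrefl _ ht
  have h := (hasSum_geometric_of_norm_lt_one hr).mul_left (x - w)⁻¹
  have h1 : (x - w)⁻¹ * (1 - (t - w) / (x - w))⁻¹ = (x - t)⁻¹ := by
    rw [← mul_inv, mul_sub, mul_one, mul_div_cancel₀ _ hxw]; congr 1; ring
  rw [h1] at h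
  refine h.congr_fun fun n => ?_
  rw [div_pow, pow_succ]
  field_simp

/-- The two signs cancel: a mass just reads off a Taylor coefficient. -/
lemma diracDeriv_eq (l : ℕ) (w : ℂ) (g : ℂ → ℂ) :
    ((-1) ^ l / (l.factorial : ℂ)) * diracDeriv l w g = taylorCoeff l g w := by
  rw [diracDeriv, taylorCoeff, ← mul_assoc, div_mul_eq_mul_div, ← mul_pow]
  simp [div_eq_inv_mul]

end Taylor

/-! ### Jordan chains -/

section Chains

variable {p : ℕ}

/-- The polynomial `∑_{m ≤ K} v_m y^m` of the first terms of a chain. -/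
def chainPoly (v : ℕ → Fin p → ℂ) (K : ℕ) (a : Fin p) : Polynomial ℂ :=
  ∑ m ∈ Finset.range (K + 1), Polynomial.C (v m a) * Polynomial.X ^ m

lemma coeff_chainPoly (v : ℕ → Fin p → ℂ) {K m : ℕ} (h : m ≤ K) (a : Fin p) :
    (chainPoly v K a).coeff m = v m a := by
  simp [chainPoly, Polynomial.finsetSum_coeff, Polynomial.coeff_C_mul, Polynomial.coeff_X_pow, h]

lemma eval_chainPoly (v : ℕ → Fin p → ℂ) (K : ℕ) (a : Fin p) (x : ℂ) :
    (chainPoly v K a).eval x = ∑ m ∈ Finset.range (K + 1), v m a * x ^ m := by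
  simp [chainPoly, Polynomial.eval_finsetSum]

lemma natDegree_chainPoly_le (v : ℕ → Fin p → ℂ) (K : ℕ) (a : Fin p) :
    (chainPoly v K a).natDegree ≤ K := by
  refine Polynomial.natDegree_sum_le_of_forall_le _ _ fun m hm => ?_
  exact (Polynomial.natDegree_C_mul_X_pow_le _ _).trans
    (Nat.lt_succ_iff.1 (Finset.mem_range.1 hm))

lemma sum_div_pow_eq (v : ℕ → Fin p → ℂ) (K : ℕ) (a : Fin p) {y : ℂ} (hy : y ≠ 0) :
    ∑ l ∈ Finset.range (K + 1), v (K - l) a / y ^ (l + 1) =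
      (chainPoly v K a).eval y / y ^ (K + 1) := by
  rw [eval_chainPoly, Finset.sum_div, ← Finset.sum_range_reflect]
  refine Finset.sum_congr rfl fun l hl => ?_
  have hl' : l ≤ K := Nat.lt_succ_iff.1 (Finset.mem_range.1 hl)
  rw [show K + 1 - 1 - l = K - l by omega, Nat.sub_sub_self hl',
    div_eq_div_iff (pow_ne_zero _ hy) (pow_ne_zero _ hy), mul_assoc, ← pow_add]
  congr 2
  omega

variable {R : Matrix (Fin p) (Fin p) (Polynomial ℂ)} {w : ℂ} {len : ℕ} {v : ℕ → Fin p → ℂ}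

/-- The chain condition of order d is the vanishing of the coefficient of y^d in v(y) R(w + y);
truncating v after y^K does not affect d ≤ K. -/
lemma IsLeftChain.dvd (h : IsLeftChain R w len v) {K : ℕ} (hK : K < len) (c : Fin p) :
    Polynomial.X ^ (K + 1) ∣ ∑ a, chainPoly v K a * Polynomial.taylor w (R a c) := by
  rw [Polynomial.X_pow_dvd_iff]
  intro d hd
  have h1 := congrFun (h d (by omega)) c
  simp only [Finset.sum_apply, Pi.smul_apply, Matrix.vecMul, dotProduct, evalDeriv,
    Matrix.map_apply, Pi.zero_apply, smul_eq_mul, Finset.mul_sum] at h1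
  rw [Polynomial.finsetSum_coeff]
  simp only [coeff_mul_eq_sum_range']
  rw [Finset.sum_comm, ← h1]
  refine Finset.sum_congr rfl fun l _ => Finset.sum_congr rfl fun a _ => ?_
  rw [coeff_chainPoly v (by omega), eval_iterate_derivative]
  have : (l.factorial : ℂ) ≠ 0 := Nat.cast_ne_zero.2 l.factorial_ne_zero
  field_simp

lemma IsRightChain.dvd (h : IsRightChain R w len v) {K : ℕ} (hK : K < len) (a : Fin p) :
    Polynomial.X ^ (K + 1) ∣ ∑ c, Polynomial.taylor w (R a c) * chainPoly v K c := by
  rw [Polynomial.X_pow_dvd_iff]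
  intro d hd
  have h1 := congrFun (h d (by omega)) a
  simp only [Finset.sum_apply, Pi.smul_apply, Matrix.mulVec, dotProduct, evalDeriv,
    Matrix.map_apply, Pi.zero_apply, smul_eq_mul, Finset.mul_sum] at h1
  rw [Polynomial.finsetSum_coeff]
  simp only [coeff_mul_eq_sum_range]
  rw [Finset.sum_comm, ← h1]
  refine Finset.sum_congr rfl fun l _ => Finset.sum_congr rfl fun c _ => ?_
  rw [coeff_chainPoly v (by omega), eval_iterate_derivative]
  have : (l.factorial : ℂ) ≠ 0 := Nat.cast_ne_zero.2 l.factorial_ne_zero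
  field_simp

/-- In the variable `y = x - w`, the polynomial row vector
`∑_{l ≤ K} y^{-(l+1)} v_{K-l} R` of a left chain. -/
def leftQuot (R : Matrix (Fin p) (Fin p) (Polynomial ℂ)) (w : ℂ) (v : ℕ → Fin p → ℂ) (K : ℕ)
    (c : Fin p) : Polynomial ℂ :=
  (∑ a, chainPoly v K a * Polynomial.taylor w (R a c)) /ₘ Polynomial.X ^ (K + 1)

lemma IsLeftChain.mul_leftQuot (h : IsLeftChain R w len v) {K : ℕ} (hK : K < len) (c : Fin p) :
    Polynomial.X ^ (K + 1) * leftQuot R w v K c =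
      ∑ a, chainPoly v K a * Polynomial.taylor w (R a c) := by
  have h1 := (Polynomial.modByMonic_eq_zero_iff_dvd (Polynomial.monic_X_pow (K + 1))).2 (h.dvd hK c)
  have h2 := Polynomial.modByMonic_add_div
    (∑ a, chainPoly v K a * Polynomial.taylor w (R a c)) (Polynomial.X ^ (K + 1))
  rwa [h1, zero_add] at h2

/-- The polynomial column vector `∑_{l ≤ K} (x - w)^{-(l+1)} R v_{K-l}` of a right chain. -/
def rightQuot (R : Matrix (Fin p) (Fin p) (Polynomial ℂ)) (w : ℂ) (v : ℕ → Fin p → ℂ) (K : ℕ)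
    (a : Fin p) : Polynomial ℂ :=
  (∑ c, R a c * Polynomial.taylor (-w) (chainPoly v K c)) /ₘ
    (Polynomial.X - Polynomial.C w) ^ (K + 1)

lemma IsRightChain.mul_rightQuot (h : IsRightChain R w len v) {K : ℕ} (hK : K < len) (a : Fin p) :
    (Polynomial.X - Polynomial.C w) ^ (K + 1) * rightQuot R w v K a =
      ∑ c, R a c * Polynomial.taylor (-w) (chainPoly v K c) := by
  have hd : (Polynomial.X - Polynomial.C w) ^ (K + 1) ∣
      ∑ c, R a c * Polynomial.taylor (-w) (chainPoly v K c) := by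
    rw [Polynomial.X_sub_C_pow_dvd_iff, ← Polynomial.taylor_apply, map_sum]
    simp only [Polynomial.taylor_mul, Polynomial.taylor_taylor, add_neg_cancel,
      Polynomial.taylor_zero]
    exact h.dvd hK a
  have h1 := (Polynomial.modByMonic_eq_zero_iff_dvd
    ((Polynomial.monic_X_sub_C w).pow (K + 1))).2 hd
  have h2 := Polynomial.modByMonic_add_div
    (∑ c, R a c * Polynomial.taylor (-w) (chainPoly v K c))
    ((Polynomial.X - Polynomial.C w) ^ (K + 1))
  rwa [h1, zero_add] at h2

lemma IsRightChain.taylor_mul_rightQuot (h : IsRightChain R w len v) {K : ℕ} (hK : K < len)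
    (a : Fin p) (z : ℂ) :
    (Polynomial.X - Polynomial.C (w - z)) ^ (K + 1) *
        Polynomial.taylor z (rightQuot R w v K a) =
      ∑ c, Polynomial.taylor z (R a c) * Polynomial.taylor (z - w) (chainPoly v K c) := by
  have h1 := congrArg (Polynomial.taylor z) (h.mul_rightQuot hK a)
  rw [map_sum, Polynomial.taylor_mul, Polynomial.taylor_pow, map_sub, Polynomial.taylor_X,
    Polynomial.taylor_C] at h1
  simp only [Polynomial.taylor_mul, Polynomial.taylor_taylor, ← sub_eq_add_neg] at h1
  rw [← h1, map_sub]
  congr 2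
  ring

lemma IsRightChain.eval_rightQuot (h : IsRightChain R w len v) {K : ℕ} (hK : K < len)
    (a : Fin p) {x : ℂ} (hx : x ≠ w) :
    (rightQuot R w v K a).eval x =
      ∑ c, (R a c).eval x *
        ∑ l ∈ Finset.range (K + 1), v (K - l) c / (x - w) ^ (l + 1) := by
  have hxw : x - w ≠ 0 := sub_ne_zero.2 hx
  have h1 := congrArg (Polynomial.eval x) (h.mul_rightQuot hK a)
  simp only [Polynomial.eval_mul, Polynomial.eval_pow, Polynomial.eval_sub, Polynomial.eval_X,
    Polynomial.eval_C, Polynomial.eval_finsetSum, Polynomial.taylor_eval, ← sub_eq_add_neg] at h1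
  simp only [sum_div_pow_eq _ _ _ hxw, mul_div_assoc']
  rw [← Finset.sum_div, ← h1, mul_div_cancel_left₀ _ (pow_ne_zero _ hxw)]

/-- The numerator has degree at most d + K and the divisor has degree K + 1, so each row loses a
degree. -/
lemma IsRightChain.coeff_rightQuot (h : IsRightChain R w len v) {K : ℕ} (hK : K < len)
    (a : Fin p) {d : ℕ} (hd : ∀ c, (R a c).natDegree ≤ d) {k : ℕ} (hk : d ≤ k) :
    (rightQuot R w v K a).coeff k = 0 := by
  by_cases h0 : rightQuot R w v K a = 0
  · rw [h0, Polynomial.coeff_zero]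
  refine Polynomial.coeff_eq_zero_of_natDegree_lt ?_
  have h1 := congrArg Polynomial.natDegree (h.mul_rightQuot hK a)
  rw [((Polynomial.monic_X_sub_C w).pow (K + 1)).natDegree_mul' h0, Polynomial.natDegree_pow,
    Polynomial.natDegree_X_sub_C] at h1
  have h2 : (∑ c, R a c * Polynomial.taylor (-w) (chainPoly v K c)).natDegree ≤ d + K := by
    refine Polynomial.natDegree_sum_le_of_forall_le _ _ fun c _ => ?_
    refine Polynomial.natDegree_mul_le.trans (add_le_add (hd c) ?_)
    rw [Polynomial.natDegree_taylor]
    exact natDegree_chainPoly_le v K c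
  omega

variable {len' : ℕ} {v' : ℕ → Fin p → ℂ}

/-- Both sides are the coefficient of y^{K+k+1} in v(y) R(w + y) v'(y), with y^{K+1} divided out
through the left chain or y^{k+1} through the right one. This identifies 𝕎 with the action of the
masses. -/
lemma coeff_leftQuot_mul (hL : IsLeftChain R w len v) {K : ℕ} (hK : K < len)
    (hR : IsRightChain R w len' v') {k : ℕ} (hk : k < len') :
    (∑ c, leftQuot R w v K c * chainPoly v' k c).coeff k =
      (∑ a, chainPoly v K a * Polynomial.taylor w (rightQuot R w v' k a)).coeff K := by
  have h1 : Polynomial.X ^ (K + 1) * ∑ c, leftQuot R w v K c * chainPoly v' k c =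
      Polynomial.X ^ (k + 1) *
        ∑ a, chainPoly v K a * Polynomial.taylor w (rightQuot R w v' k a) := by
    have h2 : ∀ a, Polynomial.X ^ (k + 1) * Polynomial.taylor w (rightQuot R w v' k a) =
        ∑ c, Polynomial.taylor w (R a c) * chainPoly v' k c := fun a => by
      have := hR.taylor_mul_rightQuot hk a w
      simpa only [sub_self, map_zero, sub_zero, Polynomial.taylor_zero] using this
    simp only [Finset.mul_sum, ← mul_assoc, hL.mul_leftQuot hK]
    simp only [mul_comm (Polynomial.X ^ (k + 1)) (chainPoly v K _), mul_assoc, h2,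
      Finset.sum_mul, Finset.mul_sum]
    exact Finset.sum_comm
  have h3 := congrArg (fun P => Polynomial.coeff P (k + (K + 1))) h1
  simp only [Polynomial.coeff_X_pow_mul] at h3
  rwa [show k + (K + 1) = K + (k + 1) by omega, Polynomial.coeff_X_pow_mul] at h3

/-- Around z ≠ w the denominator (x - w)^{k+1} is coprime to y^{K+1}, so the divisibility from the
left chain survives the division. Masses at z therefore do not see the pole vectors at w. -/
lemma dvd_taylor_rightQuot {z : ℂ} (hL : IsLeftChain R z len v) {K : ℕ} (hK : K < len)
    (hR : IsRightChain R w len' v') {k : ℕ} (hk : k < len') (hzw : z ≠ w) :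
    Polynomial.X ^ (K + 1) ∣
      ∑ a, chainPoly v K a * Polynomial.taylor z (rightQuot R w v' k a) := by
  have hcop : IsCoprime (Polynomial.X ^ (K + 1) : Polynomial ℂ)
      ((Polynomial.X - Polynomial.C (w - z)) ^ (k + 1)) := by
    refine IsCoprime.pow ?_
    have := Polynomial.isCoprime_X_sub_C_of_isUnit_sub (R := ℂ) (a := 0) (b := w - z)
      (by rw [zero_sub, neg_sub]; exact (sub_ne_zero.2 hzw).isUnit)
    simpa using this
  refine hcop.dvd_of_dvd_mul_left ?_
  have h1 : (Polynomial.X - Polynomial.C (w - z)) ^ (k + 1) *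
      ∑ a, chainPoly v K a * Polynomial.taylor z (rightQuot R w v' k a) =
      ∑ c, (∑ a, chainPoly v K a * Polynomial.taylor z (R a c)) *
        Polynomial.taylor (z - w) (chainPoly v' k c) := by
    simp only [Finset.mul_sum, Finset.sum_mul]
    rw [Finset.sum_comm]
    refine Finset.sum_congr rfl fun a _ => ?_
    rw [mul_left_comm, hR.taylor_mul_rightQuot hk a z, Finset.mul_sum]
    exact Finset.sum_congr rfl fun c _ => by ring
  rw [h1]
  exact Finset.dvd_sum fun c _ => (hL.dvd hK c).mul_right _

/-- The action of the masses of one chain vector on vectors of polynomials. -/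
lemma sum_diracDeriv_mul (v : ℕ → Fin p → ℂ) (w : ℂ) (k : ℕ) {u : ℂ → ℂ}
    (hu : ContDiffAt ℂ k u w) (Q : Fin p → Polynomial ℂ) :
    ∑ a, ∑ l ∈ Finset.range (k + 1), ((-1) ^ l / (l.factorial : ℂ)) * v (k - l) a *
        diracDeriv l w (fun t => u t * (Q a).eval t) =
      ∑ m ∈ Finset.range (k + 1), taylorCoeff m u w *
        (∑ a, chainPoly v (k - m) a * Polynomial.taylor w (Q a)).coeff (k - m) := by
  have h1 : ∀ a, ∑ l ∈ Finset.range (k + 1), ((-1) ^ l / (l.factorial : ℂ)) * v (k - l) a *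
        diracDeriv l w (fun t => u t * (Q a).eval t) =
      ∑ m ∈ Finset.range (k + 1), taylorCoeff m u w *
        (chainPoly v (k - m) a * Polynomial.taylor w (Q a)).coeff (k - m) := by
    intro a
    have h2 : ∀ l ∈ Finset.range (k + 1), ((-1) ^ l / (l.factorial : ℂ)) * v (k - l) a *
        diracDeriv l w (fun t => u t * (Q a).eval t) =
        ∑ m ∈ Finset.range (l + 1), taylorCoeff m u w *
          (Polynomial.taylor w (Q a)).coeff (l - m) * v (k - l) a := by
      intro l hl
      have hlk : l ≤ k := Nat.lt_succ_iff.1 (Finset.mem_range.1 hl)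
      rw [mul_right_comm, diracDeriv_eq, taylorCoeff_mul
        (hu.of_le (by exact_mod_cast hlk)) (contDiffAt_eval _ _), Finset.sum_mul]
      exact Finset.sum_congr rfl fun m _ => by rw [taylorCoeff_eval]
    -- After Leibniz, regrouping by the order m on u leaves the convolution of the chain with the
    -- Taylor coefficients of Q, of total order k - m.
    rw [Finset.sum_congr rfl h2, sum_triangle k (fun m l j => taylorCoeff m u w *
          (Polynomial.taylor w (Q a)).coeff l * v j a)]
    refine Finset.sum_congr rfl fun m _ => ?_
    rw [coeff_mul_eq_sum_range', Finset.mul_sum]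
    refine Finset.sum_congr rfl fun l _ => ?_
    rw [coeff_chainPoly v (Nat.sub_le _ _), mul_assoc]
  rw [Finset.sum_congr rfl fun a _ => h1 a, Finset.sum_comm]
  refine Finset.sum_congr rfl fun m _ => ?_
  rw [Polynomial.finsetSum_coeff, Finset.mul_sum]

lemma sum_diracDeriv_mul_eq_zero (v : ℕ → Fin p → ℂ) (w : ℂ) (k : ℕ) {u : ℂ → ℂ}
    (hu : ContDiffAt ℂ k u w) (Q : Fin p → Polynomial ℂ)
    (h : ∀ K ≤ k, Polynomial.X ^ (K + 1) ∣
      ∑ a, chainPoly v K a * Polynomial.taylor w (Q a)) :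
    ∑ a, ∑ l ∈ Finset.range (k + 1), ((-1) ^ l / (l.factorial : ℂ)) * v (k - l) a *
        diracDeriv l w (fun t => u t * (Q a).eval t) = 0 := by
  rw [sum_diracDeriv_mul v w k hu]
  refine Finset.sum_eq_zero fun m _ => ?_
  rw [Polynomial.X_pow_dvd_iff.1 (h _ (Nat.sub_le k m)) _ (Nat.lt_succ_self _), mul_zero]

/-- The Cauchy transform of the masses of one chain vector, multiplied by `R`, is a polynomial. -/
lemma IsLeftChain.sum_diracDeriv_cauchy (h : IsLeftChain R w len v) {k : ℕ} (hk : k < len)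
    {u : ℂ → ℂ} (hu : ContDiffAt ℂ k u w) (c : Fin p) {x : ℂ} (hx : x ≠ w) :
    ∑ l ∈ Finset.range (k + 1), ((-1) ^ l / (l.factorial : ℂ)) *
        diracDeriv l w (fun t => u t / (x - t)) * ∑ a, v (k - l) a * (R a c).eval x =
      ∑ m ∈ Finset.range (k + 1),
        taylorCoeff m u w * (leftQuot R w v (k - m) c).eval (x - w) := by
  have hxw : x - w ≠ 0 := sub_ne_zero.2 hx
  have hinv : ∀ n : ℕ, ContDiffAt ℂ n (fun t => (x - t)⁻¹) w := fun n =>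
    (contDiffAt_const.sub contDiffAt_id).inv hxw
  have h2 : ∀ l ∈ Finset.range (k + 1), ((-1) ^ l / (l.factorial : ℂ)) *
      diracDeriv l w (fun t => u t / (x - t)) * ∑ a, v (k - l) a * (R a c).eval x =
      ∑ m ∈ Finset.range (l + 1), taylorCoeff m u w *
        ((x - w) ^ (l - m + 1))⁻¹ * ∑ a, v (k - l) a * (R a c).eval x := by
    intro l hl
    have hlk : l ≤ k := Nat.lt_succ_iff.1 (Finset.mem_range.1 hl)
    simp only [div_eq_mul_inv (u _)]
    rw [diracDeriv_eq, taylorCoeff_mul (hu.of_le (by exact_mod_cast hlk)) (hinv l),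
      Finset.sum_mul]
    exact Finset.sum_congr rfl fun m _ => by rw [taylorCoeff_cauchyKernel _ hx]
  rw [Finset.sum_congr rfl h2, sum_triangle k (fun m l j => taylorCoeff m u w *
    ((x - w) ^ (l + 1))⁻¹ * ∑ a, v j a * (R a c).eval x)]
  refine Finset.sum_congr rfl fun m _ => ?_
  have h3 := congrArg (Polynomial.eval (x - w)) (h.mul_leftQuot (K := k - m) (by omega) c)
  simp only [Polynomial.eval_mul, Polynomial.eval_pow, Polynomial.eval_X,
    Polynomial.eval_finsetSum, Polynomial.taylor_eval, sub_add_cancel] at h3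
  have h4 : ∑ l ∈ Finset.range (k - m + 1), ((x - w) ^ (l + 1))⁻¹ *
      ∑ a, v (k - m - l) a * (R a c).eval x =
      ∑ a, (∑ l ∈ Finset.range (k - m + 1), v (k - m - l) a / (x - w) ^ (l + 1)) *
        (R a c).eval x := by
    simp only [Finset.mul_sum, Finset.sum_mul]
    rw [Finset.sum_comm]
    exact Finset.sum_congr rfl fun a _ => Finset.sum_congr rfl fun l _ => by
      rw [div_eq_mul_inv]; ring
  simp only [mul_assoc, ← Finset.mul_sum]
  rw [h4]
  simp only [sum_div_pow_eq _ _ _ hxw, div_mul_eq_mul_div, ← Finset.sum_div]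
  rw [← h3, mul_div_cancel_left₀ _ (pow_ne_zero _ hxw)]

end Chains

/-! ### Canonical sets of Jordan chains -/

section Canonical

variable {p : ℕ} {J : ChainData p} {R : Matrix (Fin p) (Fin p) (Polynomial ℂ)}

lemma ChainData.sum_idx (J : ChainData p)
    (F : (i : Fin J.num) → (j : Fin (J.chains i)) → Fin (J.len i j) → ℂ) :
    ∑ c, F (J.idx c).1 (J.idx c).2.1 (J.idx c).2.2 = ∑ i, ∑ j, ∑ k, F i j k := by
  rw [Equiv.sum_comp J.idx (fun t => F t.1 t.2.1 t.2.2), Fintype.sum_sigma]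
  exact Finset.sum_congr rfl fun i _ => Fintype.sum_sigma _

/-- Over ℂ the degree of det R counts its zeros with multiplicity, and the chains at x_i have total
length K_i. -/
lemma ChainData.IsCanonical.size_eq (h : J.IsCanonical R) (h0 : R.det ≠ 0) :
    J.size = R.det.natDegree := by
  have h1 : R.det.natDegree = R.det.roots.card :=
    (Polynomial.splits_iff_card_roots.1 (IsAlgClosed.splits R.det)).symm
  have h2 : R.det.roots.toFinset = Finset.univ.image J.pt := by
    ext w
    simp [Polynomial.mem_roots h0, Polynomial.IsRoot, h.eigenvalue]
  rw [h1, ← Multiset.toFinset_sum_count_eq, h2,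
    Finset.sum_image fun i _ j _ hij => h.injective hij, ChainData.size]
  exact Finset.sum_congr rfl fun i _ => by rw [h.sum_len, Polynomial.count_roots]

lemma ChainData.IsCanonical.num_le_size (h : J.IsCanonical R) (h0 : R.det ≠ 0) :
    J.num ≤ J.size := by
  have h1 : ∀ i, 1 ≤ ∑ j, J.len i j := fun i => by
    rw [h.sum_len, Nat.succ_le_iff, Polynomial.rootMultiplicity_pos h0]
    exact (h.eigenvalue _).2 ⟨i, rfl⟩
  calc J.num = ∑ _i : Fin J.num, 1 := by simp
    _ ≤ J.size := Finset.sum_le_sum fun i _ => h1 i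

/-- The polynomial column vector `R(x) ℙ(x)`, where `ℙ` is the column number `c` of the pole
vectors. -/
def poleQuot (R : Matrix (Fin p) (Fin p) (Polynomial ℂ)) (J : ChainData p) (c : Fin J.size) :
    Fin p → Polynomial ℂ :=
  rightQuot R (J.pt (J.idx c).1) (J.vR (J.idx c).1 (J.idx c).2.1) (J.idx c).2.2

lemma ChainData.IsCanonical.eval_poleQuot (h : J.IsCanonical R) (c : Fin J.size) (a : Fin p)
    {x : ℂ} (hx : ∀ i, x ≠ J.pt i) :
    (poleQuot R J c a).eval x = ∑ d, (R a d).eval x * rowP J d x c :=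
  (h.rightChain _ _).eval_rightQuot (J.idx c).2.2.2 a (hx _)

lemma rowP_eq (c : Fin J.size) (a : Fin p) {x : ℂ} (hx : x ≠ J.pt (J.idx c).1) :
    rowP J a x c = (chainPoly (J.vR (J.idx c).1 (J.idx c).2.1) (J.idx c).2.2 a).eval
      (x - J.pt (J.idx c).1) / (x - J.pt (J.idx c).1) ^ ((J.idx c).2.2.val + 1) :=
  sum_div_pow_eq _ _ _ (sub_ne_zero.2 hx)

/-- A pole vector is singular only at its own point, where the order is at most one more than its
chain index and that top coefficient is v_0. -/
lemma tendsto_pow_mul_rowP (hinj : Function.Injective J.pt) (c : Fin J.size) (a : Fin p)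
    {i : Fin J.num} {k : ℕ} (hk : (J.idx c).2.2.val ≤ k) :
    Tendsto (fun x => (x - J.pt i) ^ (k + 1) * rowP J a x c) (𝓝[≠] (J.pt i))
      (𝓝 (if (J.idx c).1 = i ∧ (J.idx c).2.2.val = k then
        J.vR (J.idx c).1 (J.idx c).2.1 0 a else 0)) := by
  set i' := (J.idx c).1 with hi'
  set k' := (J.idx c).2.2.val with hk'
  set P := chainPoly (J.vR i' (J.idx c).2.1) k' a with hP
  have hrow : ∀ x, x ≠ J.pt i' → rowP J a x c = P.eval (x - J.pt i') / (x - J.pt i') ^ (k' + 1) :=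
    fun x hx => rowP_eq c a hx
  by_cases hii : i' = i
  · have hpt : J.pt i' = J.pt i := congrArg J.pt hii
    rw [hpt] at hrow
    have hev : (fun x => (x - J.pt i) ^ (k - k') * P.eval (x - J.pt i)) =ᶠ[𝓝[≠] (J.pt i)]
        fun x => (x - J.pt i) ^ (k + 1) * rowP J a x c := by
      filter_upwards [self_mem_nhdsWithin] with x hx
      have hx' : x - J.pt i ≠ 0 := sub_ne_zero.2 hx
      rw [hrow x hx, show k + 1 = (k - k') + (k' + 1) by omega, pow_add]
      field_simp
    refine Tendsto.congr' hev ?_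
    have hcont : Continuous fun x => (x - J.pt i) ^ (k - k') * P.eval (x - J.pt i) :=
      ((continuous_id.sub continuous_const).pow _).mul
        (P.continuous.comp (continuous_id.sub continuous_const))
    have hlim := (hcont.tendsto (J.pt i)).mono_left (nhdsWithin_le_nhds (s := {J.pt i}ᶜ))
    convert hlim using 2
    rw [sub_self]
    by_cases hkk : k' = k
    · rw [if_pos ⟨hii, hkk⟩, hkk, Nat.sub_self, pow_zero, one_mul,
        ← Polynomial.coeff_zero_eq_eval_zero, hP, coeff_chainPoly _ (Nat.zero_le _)]
    · rw [if_neg fun h => hkk h.2, zero_pow (by omega), zero_mul]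
  · rw [if_neg fun h => hii h.1]
    have hne : J.pt i ≠ J.pt i' := fun h => hii (hinj h).symm
    have hne' : J.pt i - J.pt i' ≠ 0 := sub_ne_zero.2 hne
    have hev : (fun x => (x - J.pt i) ^ (k + 1) *
        (P.eval (x - J.pt i') / (x - J.pt i') ^ (k' + 1))) =ᶠ[𝓝[≠] (J.pt i)]
        fun x => (x - J.pt i) ^ (k + 1) * rowP J a x c := by
      filter_upwards [nhdsWithin_le_nhds (isOpen_ne.mem_nhds hne)] with x hx
      rw [hrow x hx]
    refine Tendsto.congr' hev ?_
    have hcont : ContinuousAt (fun x => (x - J.pt i) ^ (k + 1) *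
        (P.eval (x - J.pt i') / (x - J.pt i') ^ (k' + 1))) (J.pt i) := by
      refine ContinuousAt.mul (by fun_prop) (ContinuousAt.div ?_ (by fun_prop) (pow_ne_zero _ hne'))
      exact (P.continuous.comp (continuous_id.sub continuous_const)).continuousAt
    have hlim := hcont.tendsto.mono_left (nhdsWithin_le_nhds (s := {J.pt i}ᶜ))
    simpa using hlim

/-- Away from the eigenvalues R cancels, so a combination of pole vectors equals a polynomial
vector. Its highest-order pole then has coefficient zero, contradicting the independence of the
initial vectors of the right chains. -/
lemma ChainData.IsCanonical.indep [NeZero p] (h : J.IsCanonical R) (α : Fin J.size → ℂ)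
    (w : Fin p → Polynomial ℂ) (hw : ∑ c, α c • poleQuot R J c = mulColumn R w) : α = 0 := by
  by_contra hα
  have hne : (Finset.univ.filter fun c => α c ≠ 0).Nonempty := by
    obtain ⟨c, hc⟩ := Function.ne_iff.1 hα
    exact ⟨c, by simpa using hc⟩
  -- Maximality of k over all columns with nonzero coefficient bounds every remaining pole at x_i by
  -- order k + 1.
  obtain ⟨c₀, hc₀, hmax⟩ := Finset.exists_max_image _ (fun c => (J.idx c).2.2.val) hne
  simp only [Finset.mem_filter, Finset.mem_univ, true_and] at hc₀ hmax
  set i := (J.idx c₀).1 with hi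
  set k := (J.idx c₀).2.2.val with hk
  have hpole : ∀ x, (∀ i, x ≠ J.pt i) → ∀ a, ∑ c, α c * rowP J a x c = (w a).eval x := by
    intro x hx
    have hdet : R.det.eval x ≠ 0 := fun h0 => by
      obtain ⟨i, rfl⟩ := (h.eigenvalue x).1 h0
      exact hx i rfl
    have hRx : IsUnit (R.map (Polynomial.eval x)).det := by
      rw [show R.map (Polynomial.eval x) = (Polynomial.evalRingHom x).mapMatrix R from rfl,
        ← RingHom.map_det]
      exact isUnit_iff_ne_zero.2 hdet
    have hinj := Matrix.mulVec_injective_iff_isUnit.2 ((Matrix.isUnit_iff_isUnit_det _).2 hRx)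
    refine congrFun (hinj (a₁ := fun a => ∑ c, α c * rowP J a x c)
      (a₂ := fun a => (w a).eval x) ?_)
    ext a
    have h1 := congrArg (Polynomial.eval x) (congrFun hw a)
    simp only [Finset.sum_apply, Pi.smul_apply, Polynomial.eval_finsetSum, Polynomial.eval_smul,
      mulColumn_apply, Polynomial.eval_mul, smul_eq_mul, h.eval_poleQuot _ _ hx] at h1
    simp only [Matrix.mulVec, dotProduct, Matrix.map_apply]
    rw [← h1]
    simp only [Finset.mul_sum]
    rw [Finset.sum_comm]
    exact Finset.sum_congr rfl fun c _ => Finset.sum_congr rfl fun d _ => by ring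
  have hev : ∀ᶠ x in 𝓝[≠] (J.pt i), ∀ i', x ≠ J.pt i' := by
    rw [eventually_all]
    intro i'
    by_cases hii : J.pt i' = J.pt i
    · rw [hii]; exact self_mem_nhdsWithin
    · exact nhdsWithin_le_nhds (isOpen_ne.mem_nhds (Ne.symm hii))
  have hlim : ∀ a, ∑ c, α c * (if (J.idx c).1 = i ∧ (J.idx c).2.2.val = k then
      J.vR (J.idx c).1 (J.idx c).2.1 0 a else 0) = 0 := by
    intro a
    have h1 : Tendsto (fun x => (x - J.pt i) ^ (k + 1) * (w a).eval x) (𝓝[≠] (J.pt i)) (𝓝 0) := by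
      have hcont : Continuous fun x => (x - J.pt i) ^ (k + 1) * (w a).eval x :=
        ((continuous_id.sub continuous_const).pow _).mul (w a).continuous
      simpa using (hcont.tendsto (J.pt i)).mono_left (nhdsWithin_le_nhds (s := {J.pt i}ᶜ))
    refine tendsto_nhds_unique (Tendsto.congr' ?_ (tendsto_finsetSum Finset.univ fun c _ =>
      (?_ : Tendsto (fun x => α c * ((x - J.pt i) ^ (k + 1) * rowP J a x c)) _ _))) h1
    · filter_upwards [hev] with x hx
      rw [← hpole x hx a, Finset.mul_sum]
      exact Finset.sum_congr rfl fun c _ => by ring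
    · by_cases hc : α c = 0
      · simp [hc]
      · exact (tendsto_pow_mul_rowP h.injective c a (hmax c hc)).const_mul _
  -- The coefficient of the entry (i, j, k), or 0 when the chain j is too short to have one.
  set g : Fin (J.chains i) → ℂ := fun j =>
    ∑ l : Fin (J.len i j), if l.val = k then α (J.idx.symm ⟨i, j, l⟩) else 0 with hg
  have hsum : ∑ j, g j • J.vR i j 0 = 0 := by
    ext a
    have h1 := J.sum_idx fun i' j l => α (J.idx.symm ⟨i', j, l⟩) *
      if i' = i ∧ l.val = k then J.vR i' j 0 a else 0
    simp only [Sigma.eta, Equiv.symm_apply_apply] at h1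
    rw [hlim a, Finset.sum_eq_single i] at h1
    · simp only [true_and] at h1
      rw [Pi.zero_apply, h1, Finset.sum_apply]
      refine Finset.sum_congr rfl fun j _ => ?_
      rw [Pi.smul_apply, smul_eq_mul, hg, Finset.sum_mul]
      exact Finset.sum_congr rfl fun l _ => by split_ifs <;> simp
    · intro i' _ hii
      simp [hii]
    · simp
  have hg0 := Fintype.linearIndependent_iff.1 (h.rightIndep i) g hsum (J.idx c₀).2.1
  simp only [hg] at hg0
  rw [Finset.sum_eq_single (J.idx c₀).2.2, if_pos rfl] at hg0
  · have hc : J.idx.symm ⟨i, (J.idx c₀).2⟩ = c₀ := J.idx.symm_apply_apply c₀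
    rw [← hc] at hc₀
    exact hc₀ hg0
  · intro l _ hl
    rw [if_neg fun h => hl (Fin.ext h)]
  · simp

end Canonical

/-! ### The Geronimus perturbation -/

section Geronimus

/-- The standing assumptions on a Geronimus perturbation. -/
structure IsGeronimus {p q : ℕ} (N r : ℕ) (R : Matrix (Fin p) (Fin p) (Polynomial ℂ))
    (J : ChainData p) (μ : Fin q → Fin p → ComplexMeasure ℝ) (Δ : Set ℝ)
    (ξ : MassFunctions J q) : Prop where
  one_le : 1 ≤ N
  lt : r < p
  normalized : IsNormalized N r R
  canonical : J.IsCanonical R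
  closed : IsClosed Δ
  supp : ∀ b a, (μ b a).variation Δᶜ = 0
  moments : ∀ b a, ∀ n : ℕ, (μ b a).Integrable (fun t : ℝ => (t : ℂ) ^ n)
  spectrum : ∀ t ∈ Δ, R.det.eval (t : ℂ) ≠ 0
  smooth : ∀ i j, ∀ k < J.len i j, ContDiffAt ℂ k (ξ i j k) (J.pt i)

variable {p q N r : ℕ} [NeZero p] {R : Matrix (Fin p) (Fin p) (Polynomial ℂ)}
  {J : ChainData p} {μ : Fin q → Fin p → ComplexMeasure ℝ} {Δ : Set ℝ} {ξ : MassFunctions J q}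

omit [NeZero p] in
lemma evalDeriv_zero (t : ℂ) : evalDeriv R 0 t = (Polynomial.evalRingHom t).mapMatrix R := rfl

omit [NeZero p] in
lemma det_evalDeriv_zero (t : ℂ) : (evalDeriv R 0 t).det = R.det.eval t := by
  rw [evalDeriv_zero, ← RingHom.map_det]; rfl

omit [NeZero p] in
lemma inv_evalDeriv_apply (t : ℂ) (c a : Fin p) :
    (evalDeriv R 0 t)⁻¹ c a = (R.adjugate c a).eval t / R.det.eval t := by
  rw [Matrix.inv_def, det_evalDeriv_zero, evalDeriv_zero, ← RingHom.map_adjugate,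
    Ring.inverse_eq_inv', Matrix.smul_apply, smul_eq_mul, div_eq_inv_mul]
  rfl

namespace IsGeronimus

omit [NeZero p] in
lemma mul_sub_pos (h : IsGeronimus N r R J μ Δ ξ) : 0 < N * p - r := by
  have := h.lt
  have := Nat.le_mul_of_pos_left p h.one_le
  omega

lemma degree_pos (h : IsGeronimus N r R J μ Δ ξ) : 0 < R.det.degree := by
  rw [← Polynomial.natDegree_pos_iff_degree_pos, h.normalized.natDegree_det h.one_le h.lt]
  exact h.mul_sub_pos

lemma det_ne_zero (h : IsGeronimus N r R J μ Δ ξ) : R.det ≠ 0 :=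
  Polynomial.ne_zero_of_degree_gt h.degree_pos

lemma size_eq (h : IsGeronimus N r R J μ Δ ξ) : J.size = N * p - r := by
  rw [h.canonical.size_eq h.det_ne_zero, h.normalized.natDegree_det h.one_le h.lt]

lemma size_pos (h : IsGeronimus N r R J μ Δ ξ) : 0 < J.size := by
  rw [h.size_eq]; exact h.mul_sub_pos

lemma num_pos (h : IsGeronimus N r R J μ Δ ξ) : 0 < J.num :=
  (J.idx ⟨0, h.size_pos⟩).1.pos

omit [NeZero p] in
lemma ne_pt (h : IsGeronimus N r R J μ Δ ξ) (i : Fin J.num) : ∀ t ∈ Δ, (t : ℂ) ≠ J.pt i :=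
  fun t ht hti => h.spectrum t ht ((h.canonical.eigenvalue _).2 ⟨i, hti.symm⟩)

lemma integrable_inv (h : IsGeronimus N r R J μ Δ ξ) (b : Fin q) (c a d : Fin p)
    (f : Polynomial ℂ) :
    (μ b d).Integrable (fun t : ℝ => f.eval (t : ℂ) * (evalDeriv R 0 (t : ℂ))⁻¹ c a) := by
  have := integrable_eval_div (h.supp b d) (h.moments b d) h.closed (f * R.adjugate c a)
    h.degree_pos h.spectrum
  simpa [inv_evalDeriv_apply, mul_div_assoc] using this

/-- Under the integral R⁻¹ g = y. The vector y need not be polynomial: it is a unit vector when g is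
a column of R, and a pole vector when g is some Q_c. -/
lemma sum_cint_inv (h : IsGeronimus N r R J μ Δ ξ) (b : Fin q) (f : Polynomial ℂ)
    {g : Fin p → Polynomial ℂ} {y : Fin p → ℝ → ℂ}
    (hg : ∀ t ∈ Δ, ∀ a, (g a).eval (t : ℂ) = ∑ c, (R a c).eval (t : ℂ) * y c t) :
    ∑ a, ∑ c, cint (μ b c) (fun t => (f * g a).eval (t : ℂ) * (evalDeriv R 0 (t : ℂ))⁻¹ c a) =
      ∑ c, cint (μ b c) (fun t => f.eval (t : ℂ) * y c t) := by
  rw [Finset.sum_comm]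
  refine Finset.sum_congr rfl fun c _ => ?_
  rw [← cint_sum _ fun a _ => h.integrable_inv b c a c (f * g a)]
  refine cint_congr (h.supp b c) fun t ht => ?_
  have hu : IsUnit (evalDeriv R 0 (t : ℂ)).det := by
    rw [det_evalDeriv_zero]; exact isUnit_iff_ne_zero.2 (h.spectrum t ht)
  have h1 : Matrix.mulVec (evalDeriv R 0 (t : ℂ)) (fun c => y c t) = fun a => (g a).eval (t : ℂ) := by
    ext a
    rw [hg t ht a]; rfl
  have h2 : Matrix.mulVec (evalDeriv R 0 (t : ℂ))⁻¹ (fun a => (g a).eval (t : ℂ)) c = y c t := by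
    rw [← h1, Matrix.mulVec_mulVec, Matrix.nonsing_inv_mul _ hu, Matrix.one_mulVec]
  rw [← h2, Matrix.mulVec, dotProduct, Finset.mul_sum]
  exact Finset.sum_congr rfl fun a _ => by rw [Polynomial.eval_mul]; ring

omit [NeZero p] in
lemma contDiffAt (h : IsGeronimus N r R J μ Δ ξ) {i : Fin J.num} {j : Fin (J.chains i)} {k : ℕ}
    (hk : k < J.len i j) (b : Fin q) (f : Polynomial ℂ) :
    ContDiffAt ℂ k (fun t => ξ i j k t b * f.eval t) (J.pt i) :=
  (contDiffAt_pi.1 (h.smooth i j k hk) b).mul (contDiffAt_eval f _)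

/-- The perturbed functional on polynomials. -/
def perturbedPoly (h : IsGeronimus N r R J μ Δ ξ) (b : Fin q) (a : Fin p) :
    Polynomial ℂ →ₗ[ℂ] ℂ where
  toFun f := perturbed μ R J ξ b a (fun t => f.eval t)
  map_add' f g := by
    have h1 : ∀ c, cint (μ b c) (fun t => (f + g).eval (t : ℂ) * (evalDeriv R 0 (t : ℂ))⁻¹ c a) =
        cint (μ b c) (fun t => f.eval (t : ℂ) * (evalDeriv R 0 (t : ℂ))⁻¹ c a) +
        cint (μ b c) (fun t => g.eval (t : ℂ) * (evalDeriv R 0 (t : ℂ))⁻¹ c a) := fun c => by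
      rw [← cint_add (h.integrable_inv b c a c f) (h.integrable_inv b c a c g)]
      simp only [Polynomial.eval_add, add_mul]
    -- Additivity of the masses, unlike homogeneity, uses the differentiability of ξ at the points
    -- x_i.
    have h2 : ∀ i j, ∀ k ∈ Finset.range (J.len i j), ∀ l ∈ Finset.range (k + 1),
        diracDeriv l (J.pt i) (fun t => ξ i j k t b * (f + g).eval t) =
        diracDeriv l (J.pt i) (fun t => ξ i j k t b * f.eval t) +
        diracDeriv l (J.pt i) (fun t => ξ i j k t b * g.eval t) := by
      intro i j k hk l hl
      have hlk : (l : WithTop ℕ∞) ≤ k := by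
        exact_mod_cast Nat.lt_succ_iff.1 (Finset.mem_range.1 hl)
      have hk' := Finset.mem_range.1 hk
      simp only [diracDeriv, Polynomial.eval_add, mul_add]
      rw [iteratedDeriv_fun_add ((h.contDiffAt hk' b f).of_le hlk)
        ((h.contDiffAt hk' b g).of_le hlk), mul_add]
    simp only [perturbed]
    rw [Finset.sum_congr rfl fun c _ => h1 c, Finset.sum_add_distrib, add_add_add_comm]
    congr 1
    simp only [← Finset.sum_add_distrib]
    refine Finset.sum_congr rfl fun i _ => Finset.sum_congr rfl fun j _ =>
      Finset.sum_congr rfl fun k hk => Finset.sum_congr rfl fun l hl => ?_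
    rw [h2 i j k hk l hl, mul_add]
  map_smul' z f := by
    have h1 : ∀ c, cint (μ b c) (fun t => (z • f).eval (t : ℂ) * (evalDeriv R 0 (t : ℂ))⁻¹ c a) =
        z * cint (μ b c) (fun t => f.eval (t : ℂ) * (evalDeriv R 0 (t : ℂ))⁻¹ c a) := fun c => by
      rw [← cint_const_mul]
      simp only [Polynomial.eval_smul, smul_eq_mul, mul_assoc]
    have h2 : ∀ i j k l, diracDeriv l (J.pt i) (fun t => ξ i j k t b * (z • f).eval t) =
        z * diracDeriv l (J.pt i) (fun t => ξ i j k t b * f.eval t) := by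
      intro i j k l
      simp only [diracDeriv, Polynomial.eval_smul, smul_eq_mul, mul_left_comm _ z]
      rw [iteratedDeriv_const_mul_field, mul_left_comm]
    simp only [perturbed, h1, h2, RingHom.id_apply, smul_eq_mul, mul_add, Finset.mul_sum,
      mul_left_comm z]

lemma perturbedPoly_eq (h : IsGeronimus N r R J μ Δ ξ) (b : Fin q) (a : Fin p)
    (f : Polynomial ℂ) :
    h.perturbedPoly b a f = perturbed μ R J ξ b a (fun t => f.eval t) := rfl

lemma perturbedPoly_apply (h : IsGeronimus N r R J μ Δ ξ) (b : Fin q) (a : Fin p)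
    (f : Polynomial ℂ) :
    h.perturbedPoly b a f = (∑ c, cint (μ b c)
        (fun t => f.eval (t : ℂ) * (evalDeriv R 0 (t : ℂ))⁻¹ c a)) +
      ∑ i, ∑ j, ∑ k ∈ Finset.range (J.len i j), ∑ l ∈ Finset.range (k + 1),
        ((-1) ^ l / (l.factorial : ℂ)) * J.vL i j (k - l) a *
          diracDeriv l (J.pt i) (fun t => ξ i j k t b * f.eval t) := rfl

/-- The functional `f, g ↦ ∑_a μ̌_{b,a}(f g_a)` on a column vector `g` of polynomials. -/
lemma sum_perturbedPoly (h : IsGeronimus N r R J μ Δ ξ) (b : Fin q) (f : Polynomial ℂ)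
    (g : Fin p → Polynomial ℂ) :
    ∑ a, h.perturbedPoly b a (f * g a) = (∑ a, ∑ c, cint (μ b c)
        (fun t => (f * g a).eval (t : ℂ) * (evalDeriv R 0 (t : ℂ))⁻¹ c a)) +
      ∑ i, ∑ j, ∑ k ∈ Finset.range (J.len i j), ∑ a, ∑ l ∈ Finset.range (k + 1),
        ((-1) ^ l / (l.factorial : ℂ)) * J.vL i j (k - l) a *
          diracDeriv l (J.pt i) (fun t => ξ i j k t b * f.eval t * (g a).eval t) := by
  simp only [h.perturbedPoly_apply, Finset.sum_add_distrib, Polynomial.eval_mul, mul_assoc]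
  congr 1
  rw [Finset.sum_comm]
  refine Finset.sum_congr rfl fun i _ => ?_
  rw [Finset.sum_comm]
  refine Finset.sum_congr rfl fun j _ => ?_
  rw [Finset.sum_comm]

lemma sum_perturbed_mul (h : IsGeronimus N r R J μ Δ ξ) (b : Fin q) (a : Fin p)
    (f : Polynomial ℂ) :
    ∑ c, h.perturbedPoly b c (f * R c a) = ofMeasures μ b a (fun t => f.eval t) := by
  rw [h.sum_perturbedPoly b f fun c => R c a,
    h.sum_cint_inv b f (y := fun c _ => if c = a then 1 else 0) (fun t _ c => by simp),
    Finset.sum_eq_single a (fun c _ hc => by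
      simpa [hc] using cint_const_mul (ν := μ b c) 0 fun _ => 0) (by simp)]
  rw [Finset.sum_eq_zero, add_zero]
  · simp [ofMeasures]
  · intro i _
    refine Finset.sum_eq_zero fun j _ => Finset.sum_eq_zero fun k hk => ?_
    have hk' := Finset.mem_range.1 hk
    exact sum_diracDeriv_mul_eq_zero _ _ _ (h.contDiffAt hk' b f) _ fun K hK =>
      (h.canonical.leftChain i j).dvd (hK.trans_lt hk') a

/-- The Taylor polynomial in `x - x_i` of `massCauchy`. -/
def massPoly (R : Matrix (Fin p) (Fin p) (Polynomial ℂ)) (J : ChainData p)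
    (ξ : MassFunctions J q) (B : ℕ → Fin q → Polynomial ℂ) (n : ℕ) (i : Fin J.num) (c : Fin p) :
    Polynomial ℂ :=
  ∑ j, ∑ k ∈ Finset.range (J.len i j), ∑ m ∈ Finset.range (k + 1),
    Polynomial.C (∑ b, taylorCoeff m (fun t => ξ i j k t b * (B n b).eval t) (J.pt i)) *
      leftQuot R (J.pt i) (J.vL i j) (k - m) c

omit [NeZero p] in
-- The left chains cancel the poles of the Cauchy transform of the masses once it is multiplied by
-- R.
lemma massCauchy_eq (h : IsGeronimus N r R J μ Δ ξ) (B : ℕ → Fin q → Polynomial ℂ) (n : ℕ)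
    (i : Fin J.num) (c : Fin p) {x : ℂ} (hx : x ≠ J.pt i) :
    massCauchy R J ξ B n i c x = (Polynomial.taylor (-J.pt i) (massPoly R J ξ B n i c)).eval x := by
  rw [Polynomial.taylor_eval, ← sub_eq_add_neg]
  simp only [massCauchy, massPoly, Polynomial.eval_finsetSum, Polynomial.eval_mul,
    Polynomial.eval_C]
  refine Finset.sum_congr rfl fun j _ => Finset.sum_congr rfl fun k hk => ?_
  have hk' := Finset.mem_range.1 hk
  have hu : ∀ b ∈ Finset.univ, ContDiffAt ℂ k (fun t => ξ i j k t b * (B n b).eval t) (J.pt i) :=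
    fun b _ => h.contDiffAt hk' b (B n b)
  have h1 := (h.canonical.leftChain i j).sum_diracDeriv_cauchy hk'
    (u := fun t => ∑ b, ξ i j k t b * (B n b).eval t) (ContDiffAt.sum hu) c hx
  simp only [mul_comm (Polynomial.eval _ (B n _))]
  rw [h1]
  refine Finset.sum_congr rfl fun m hm => ?_
  have hmk : (m : WithTop ℕ∞) ≤ k := by
    exact_mod_cast Nat.lt_succ_iff.1 (Finset.mem_range.1 hm)
  rw [taylorCoeff_sum _ fun b hb => (hu b hb).of_le hmk]

omit [NeZero p] in
-- On the open set x ≠ x_i the function is a polynomial, so its derivatives are too and extend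
-- continuously to x_i; the chain operator there is a convolution of Taylor coefficients.
lemma tendsto_preW (h : IsGeronimus N r R J μ Δ ξ) (B : ℕ → Fin q → Polynomial ℂ) (n : ℕ)
    (i : Fin J.num) (j : Fin (J.chains i)) (k : ℕ) :
    Tendsto (preW R J ξ B n i j k) (𝓝[≠] (J.pt i))
      (𝓝 ((∑ c, massPoly R J ξ B n i c * chainPoly (J.vR i j) k c).coeff k)) := by
  set G := fun c => Polynomial.taylor (-J.pt i) (massPoly R J ξ B n i c) with hG
  have hder : ∀ (l : ℕ) (c : Fin p), ∀ x ≠ J.pt i,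
      iteratedDeriv l (massCauchy R J ξ B n i c) x =
        (Polynomial.derivative^[l] (G c)).eval x := by
    intro l c x hx
    rw [Filter.EventuallyEq.iteratedDeriv_eq l (g := fun x => (G c).eval x) ?_,
      iteratedDeriv_eval]
    filter_upwards [isOpen_ne.mem_nhds hx] with y hy using h.massCauchy_eq B n i c hy
  have hev : (fun x => ∑ l ∈ Finset.range (k + 1), (1 / (l.factorial : ℂ)) *
      ∑ c, (Polynomial.derivative^[l] (G c)).eval x * J.vR i j (k - l) c) =ᶠ[𝓝[≠] (J.pt i)]
      preW R J ξ B n i j k := by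
    filter_upwards [self_mem_nhdsWithin] with x hx
    rw [preW]
    simp only [hder _ _ x hx]
  refine Tendsto.congr' hev ?_
  have hcont : Continuous fun x => ∑ l ∈ Finset.range (k + 1), (1 / (l.factorial : ℂ)) *
      ∑ c, (Polynomial.derivative^[l] (G c)).eval x * J.vR i j (k - l) c := by
    refine continuous_finsetSum _ fun l _ => continuous_const.mul
      (continuous_finsetSum _ fun c _ => ?_)
    exact (Polynomial.continuous _).mul continuous_const
  have hlim := (hcont.tendsto (J.pt i)).mono_left (nhdsWithin_le_nhds (s := {J.pt i}ᶜ))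
  convert hlim using 2
  rw [Polynomial.finsetSum_coeff]
  simp only [coeff_mul_eq_sum_range]
  rw [Finset.sum_comm]
  refine Finset.sum_congr rfl fun l _ => ?_
  rw [Finset.mul_sum]
  refine Finset.sum_congr rfl fun c _ => ?_
  rw [coeff_chainPoly _ (Nat.sub_le k l), eval_iterate_derivative, hG, Polynomial.taylor_taylor,
    add_neg_cancel, Polynomial.taylor_zero]
  have : (l.factorial : ℂ) ≠ 0 := Nat.cast_ne_zero.2 l.factorial_ne_zero
  field_simp

omit [NeZero p] in
lemma blockW_eq (h : IsGeronimus N r R J μ Δ ξ) (B : ℕ → Fin q → Polynomial ℂ) (n : ℕ)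
    (i : Fin J.num) (j : Fin (J.chains i)) (k : ℕ) :
    blockW R J ξ B n i j k =
      (∑ c, massPoly R J ξ B n i c * chainPoly (J.vR i j) k c).coeff k :=
  (h.tendsto_preW B n i j k).limUnder_eq

/-- Differentiating the Cauchy kernel at x_i produces the powers (t - x_i)^{-(l+1)}, with a minus
sign; weighted by the right chain they assemble to ℙ_c = R⁻¹ Q_c. -/
lemma blockD_eq (h : IsGeronimus N r R J μ Δ ξ) (B : ℕ → Fin q → Polynomial ℂ) (n : ℕ)
    (c : Fin J.size) :
    blockD μ J B n (J.idx c).1 (J.idx c).2.1 (J.idx c).2.2 =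
      -∑ b, ∑ a, ∑ d, cint (μ b d) (fun t => (B n b * poleQuot R J c a).eval (t : ℂ) *
        (evalDeriv R 0 (t : ℂ))⁻¹ d a) := by
  set i := (J.idx c).1
  set v := J.vR i (J.idx c).2.1 with hv
  set k := (J.idx c).2.2.val with hk
  have hne := h.ne_pt i
  have hint : ∀ (l : ℕ) (b : Fin q) (a : Fin p), (μ b a).Integrable
      (fun t : ℝ => (B n b).eval (t : ℂ) / ((t : ℂ) - J.pt i) ^ (l + 1)) := fun l b a => by
    have := integrable_eval_div (h.supp b a) (h.moments b a) h.closed (B n b)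
      (P := (Polynomial.X - Polynomial.C (J.pt i)) ^ (l + 1))
      (by rw [Polynomial.degree_pow, Polynomial.degree_X_sub_C]; simp; positivity)
      (fun t ht => by simpa using sub_ne_zero.2 (hne t ht))
    simpa using this
  have h1 : ∀ b, ∑ a, ∑ d, cint (μ b d) (fun t => (B n b * poleQuot R J c a).eval (t : ℂ) *
        (evalDeriv R 0 (t : ℂ))⁻¹ d a) =
      ∑ a, ∑ l ∈ Finset.range (k + 1), v (k - l) a *
        cint (μ b a) (fun t => (B n b).eval (t : ℂ) / ((t : ℂ) - J.pt i) ^ (l + 1)) := by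
    intro b
    rw [h.sum_cint_inv b (B n b) (g := poleQuot R J c) (y := fun a t => rowP J a t c)
      fun t ht a => h.canonical.eval_poleQuot c a fun i => h.ne_pt i t ht]
    refine Finset.sum_congr rfl fun a _ => ?_
    simp only [← cint_const_mul]
    rw [← cint_sum _ fun l _ => (hint l b a).const_mul _]
    congr 1
    ext t
    rw [rowP, Finset.mul_sum]
    exact Finset.sum_congr rfl fun l _ => by ring
  rw [Finset.sum_congr rfl fun b _ => h1 b, blockD]
  change ∑ l ∈ Finset.range (k + 1), (1 / (l.factorial : ℂ)) *
    ∑ a, iteratedDeriv l (cauchyD μ B n a) (J.pt i) * v (k - l) a = _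
  simp only [iteratedDeriv_cauchyD h.closed h.supp h.moments B n _ hne]
  rw [← Finset.sum_neg_distrib]
  simp only [← Finset.sum_neg_distrib, Finset.mul_sum, Finset.sum_mul]
  rw [Finset.sum_congr rfl fun l _ => Finset.sum_comm, Finset.sum_comm]
  refine Finset.sum_congr rfl fun b _ => ?_
  rw [Finset.sum_comm]
  refine Finset.sum_congr rfl fun a _ => Finset.sum_congr rfl fun l _ => ?_
  have : (l.factorial : ℂ) ≠ 0 := Nat.cast_ne_zero.2 l.factorial_ne_zero
  field_simp

omit [NeZero p] in
lemma sum_masses_poleQuot (h : IsGeronimus N r R J μ Δ ξ) (B : ℕ → Fin q → Polynomial ℂ) (n : ℕ)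
    (c : Fin J.size) :
    blockW R J ξ B n (J.idx c).1 (J.idx c).2.1 (J.idx c).2.2 =
      ∑ b, ∑ i, ∑ j, ∑ k ∈ Finset.range (J.len i j), ∑ a, ∑ l ∈ Finset.range (k + 1),
        ((-1) ^ l / (l.factorial : ℂ)) * J.vL i j (k - l) a * diracDeriv l (J.pt i)
          (fun t => ξ i j k t b * (B n b).eval t * (poleQuot R J c a).eval t) := by
  have hRc := h.canonical.rightChain (J.idx c).1 (J.idx c).2.1
  have hkc := (J.idx c).2.2.2
  have hother : ∀ b, ∀ i, i ≠ (J.idx c).1 →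
      ∑ j, ∑ k ∈ Finset.range (J.len i j), ∑ a, ∑ l ∈ Finset.range (k + 1),
        ((-1) ^ l / (l.factorial : ℂ)) * J.vL i j (k - l) a * diracDeriv l (J.pt i)
          (fun t => ξ i j k t b * (B n b).eval t * (poleQuot R J c a).eval t) = 0 := by
    intro b i hi
    refine Finset.sum_eq_zero fun j _ => Finset.sum_eq_zero fun k hk => ?_
    have hk' := Finset.mem_range.1 hk
    exact sum_diracDeriv_mul_eq_zero _ _ _ (h.contDiffAt hk' b (B n b)) _ fun K hK =>
      dvd_taylor_rightQuot (h.canonical.leftChain i j) (hK.trans_lt hk') hRc hkc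
        (h.canonical.injective.ne hi)
  rw [Finset.sum_congr rfl fun b _ => Finset.sum_eq_single (J.idx c).1
    (fun i _ hi => hother b i hi) (by simp), blockW_eq h, Finset.sum_comm,
    Polynomial.finsetSum_coeff]
  simp only [massPoly, Finset.sum_mul, Polynomial.finsetSum_coeff]
  rw [Finset.sum_comm]
  refine Finset.sum_congr rfl fun j _ => ?_
  rw [Finset.sum_comm, Finset.sum_comm (s := Finset.univ)]
  refine Finset.sum_congr rfl fun k hk => ?_
  have hk' := Finset.mem_range.1 hk
  rw [Finset.sum_comm, Finset.sum_congr rfl fun b _ => sum_diracDeriv_mul _ _ _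
    (h.contDiffAt hk' b (B n b)) _, Finset.sum_comm (s := Finset.univ)]
  refine Finset.sum_congr rfl fun m _ => ?_
  rw [← Finset.sum_mul]
  rw [show (fun a => chainPoly (J.vL (J.idx c).1 j) (k - m) a *
      Polynomial.taylor (J.pt (J.idx c).1) (poleQuot R J c a)) = fun a =>
      chainPoly (J.vL (J.idx c).1 j) (k - m) a * Polynomial.taylor (J.pt (J.idx c).1)
        (rightQuot R (J.pt (J.idx c).1) (J.vR (J.idx c).1 (J.idx c).2.1) (J.idx c).2.2 a) from rfl,
    ← coeff_leftQuot_mul (h.canonical.leftChain (J.idx c).1 j) (by omega) hRc hkc,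
    Polynomial.finsetSum_coeff, Finset.mul_sum]
  refine Finset.sum_congr rfl fun a _ => ?_
  rw [mul_assoc, Polynomial.coeff_C_mul]

lemma rowDW_eq [NeZero q] (h : IsGeronimus N r R J μ Δ ξ) (B : ℕ → Fin q → Polynomial ℂ) (n : ℕ)
    (c : Fin J.size) :
    rowDW μ R J ξ B n c = -pairing h.perturbedPoly (B n) (poleQuot R J c) := by
  rw [rowDW, h.blockD_eq, h.sum_masses_poleQuot, pairing_apply,
    Finset.sum_congr rfl fun b _ => h.sum_perturbedPoly b (B n b) (poleQuot R J c),
    Finset.sum_add_distrib]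
  ring

end IsGeronimus

end Geronimus

/-! ### The Christoffel-type formulas -/

section Formulas

variable {p q N r : ℕ} [NeZero p] [NeZero q] {R : Matrix (Fin p) (Fin p) (Polynomial ℂ)}
  {J : ChainData p} {μ : Fin q → Fin p → ComplexMeasure ℝ} {Δ : Set ℝ} {ξ : MassFunctions J q}
  {S Sbar S' Sbar' : ℕ → ℕ → ℂ} {H H' : ℕ → ℂ}

lemma momentMatrix_eq {L : Functional q p} {L' : Fin q → Fin p → Polynomial ℂ →ₗ[ℂ] ℂ}
    (h : ∀ b a f, L' b a f = L b a (fun t => f.eval t)) :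
    momentMatrix L = fun m n => L' (Fin.ofNat q m) (Fin.ofNat p n)
      (Polynomial.X ^ (m / q) * Polynomial.X ^ (n / p)) := by
  ext m n
  rw [h, momentMatrix]
  simp only [Polynomial.eval_mul, Polynomial.eval_pow, Polynomial.eval_X]

namespace IsGeronimus

omit [NeZero q] in
-- Row a of Q_c has degree below the row degree of R. The highest positions allowed are (N-1)p + a
-- with a < p - r, and (N-2)p + a for the other rows, all less than N p - r.
lemma poleQuot_mem (h : IsGeronimus N r R J μ Δ ξ) (c : Fin J.size) :
    poleQuot R J c ∈ flag (stdVec p) J.size := by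
  refine mem_flag_stdVec fun a k hk => ?_
  refine (h.canonical.rightChain _ _).coeff_rightQuot (J.idx c).2.2.2 a
    (d := rowDegree N r a) (h.normalized.natDegree_le a) ?_
  rw [h.size_eq] at hk
  have ha := a.2
  have hr := h.lt
  by_contra hlt
  unfold rowDegree at hlt
  split_ifs at hlt with har
  · have h1 : (k + 1) * p ≤ N * p := Nat.mul_le_mul_right p (by omega)
    rw [add_mul] at h1
    omega
  · have h1 : (k + 2) * p ≤ N * p := Nat.mul_le_mul_right p (by omega)
    rw [add_mul] at h1
    omega

lemma pairing_mulColumn (h : IsGeronimus N r R J μ Δ ξ)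
    (hLU : IsGaussBorel (momentMatrix (ofMeasures μ)) S H Sbar) (m n : ℕ) :
    pairing h.perturbedPoly (polyB S m) (mulColumn R (polyA Sbar H n)) = if m = n then 1 else 0 := by
  -- The functional dμ on polynomials, written as dμ̌ R so that its linearity is inherited.
  set L₀ : Fin q → Fin p → Polynomial ℂ →ₗ[ℂ] ℂ := fun b a =>
    ∑ c, (h.perturbedPoly b c).comp (LinearMap.mulRight ℂ (R c a)) with hL₀
  have hL₀' : ∀ b a f, L₀ b a f = ∑ c, h.perturbedPoly b c (f * R c a) := fun b a f => by
    simp [hL₀]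
  rw [momentMatrix_eq fun b a f => (hL₀' b a f).trans (h.sum_perturbed_mul b a f)] at hLU
  rw [← hLU.biorth m n, pairing_apply, pairing_apply]
  refine Finset.sum_congr rfl fun b _ => ?_
  simp only [hL₀', mulColumn_apply, Finset.mul_sum, map_sum]
  rw [Finset.sum_comm]
  exact Finset.sum_congr rfl fun a _ => Finset.sum_congr rfl fun c _ => by
    rw [mul_left_comm, mul_comm (R c a)]

lemma isConnected (h : IsGeronimus N r R J μ Δ ξ)
    (hLU : IsGaussBorel (momentMatrix (ofMeasures μ)) S H Sbar)
    (hLU' : IsGaussBorel (momentMatrix (perturbed μ R J ξ)) S' H' Sbar') :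
    IsConnected J.size (pairing h.perturbedPoly) (mulColumn R) (polyB S) (polyB S')
      (polyA Sbar H) (polyA Sbar' H') (poleQuot R J) where
  flag_left n := by rw [hLU.left.flag_polyB, hLU'.left.flag_polyB]
  flag_right n := by rw [flag_polyA hLU.right hLU.diag, flag_polyA hLU'.right hLU'.diag]
  monic n := by
    rw [hLU.left.flag_polyB, ← sub_sub_sub_cancel_right _ _ (stdVec q n)]
    exact sub_mem (hLU'.left.sub_mem n) (hLU.left.sub_mem n)
  biorth := h.pairing_mulColumn hLU
  biorth' := by
    rw [momentMatrix_eq h.perturbedPoly_eq] at hLU'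
    exact hLU'.biorth
  shift n := by
    rw [flag_polyA hLU.right hLU.diag, h.size_eq]
    refine h.normalized.mulColumn_mem h.one_le h.lt ?_
    rw [← flag_polyA hLU.right hLU.diag]
    exact mem_flag _ n.lt_succ_self
  mem c := by
    rw [flag_polyA hLU.right hLU.diag]
    exact h.poleQuot_mem c
  indep := h.canonical.indep

lemma tau_ne_zero (h : IsGeronimus N r R J μ Δ ξ)
    (hLU : IsGaussBorel (momentMatrix (ofMeasures μ)) S H Sbar)
    (hLU' : IsGaussBorel (momentMatrix (perturbed μ R J ξ)) S' H' Sbar') (n : ℕ) :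
    tau μ R J ξ (polyB S) n ≠ 0 := by
  have := (h.isConnected hLU hLU').det_ne_zero (n + 1 - J.size)
  simpa only [tau, h.rowDW_eq] using this

lemma eval_polyB (h : IsGeronimus N r R J μ Δ ξ)
    (hLU : IsGaussBorel (momentMatrix (ofMeasures μ)) S H Sbar)
    (hLU' : IsGaussBorel (momentMatrix (perturbed μ R J ξ)) S' H' Sbar') {n : ℕ}
    (hn : J.size ≤ n) (b : Fin q) (x : ℂ) :
    (polyB S' n b).eval x =
      1 / tau μ R J ξ (polyB S) (n - 1) * detB μ R J ξ (polyB S) n b x := by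
  obtain ⟨ω, h1, hB, hω⟩ := (h.isConnected hLU hLU').left_formula hn
  have hτ := h.tau_ne_zero hLU hLU' (n - 1)
  have hdet : detB μ R J ξ (polyB S) n b x =
      tau μ R J ξ (polyB S) (n - 1) * ∑ ρ, ω ρ * (polyB S (n - J.size + ρ) b).eval x := by
    -- The matrix of τ_{n-1} consists of the rows of `detB` other than the last, without the last
    -- column.
    have hn1 : n - 1 + 1 - J.size = n - J.size := by have := h.size_pos; omega
    rw [detB, tau, hn1]
    refine det_snoc (fun ρ => rowDW μ R J ξ (polyB S) (n - J.size + ρ)) _ ω h1 fun c => ?_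
    simp only [h.rowDW_eq, mul_neg, Finset.sum_neg_distrib, hω c, neg_zero]
  rw [hdet, hB, Finset.sum_apply, Polynomial.eval_finsetSum, one_div, inv_mul_cancel_left₀ hτ]
  simp

lemma eval_polyA (h : IsGeronimus N r R J μ Δ ξ)
    (hLU : IsGaussBorel (momentMatrix (ofMeasures μ)) S H Sbar)
    (hLU' : IsGaussBorel (momentMatrix (perturbed μ R J ξ)) S' H' Sbar') {n : ℕ}
    (hn : J.size ≤ n) (a : Fin p) {x : ℂ} (hx : R.det.eval x ≠ 0) :
    (polyA Sbar' H' n a).eval x =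
      -∑ c, (R a c).eval x / tau μ R J ξ (polyB S) n *
        detA μ R J ξ (polyA Sbar H) (polyB S) n c x := by
  have hs := h.size_pos
  have hM := h.num_pos
  have hMs := h.canonical.num_le_size h.det_ne_zero
  have hτ := h.tau_ne_zero hLU hLU' n
  set E : Matrix (Fin J.size) (Fin J.size) ℂ :=
    Matrix.of fun ρ c => rowDW μ R J ξ (polyB S) (n + 1 - J.size + ρ) c with hE
  set ρ₀ : Fin J.size := ⟨J.size - 1, by omega⟩ with hρ₀
  have hρ : ∀ ρ : Fin J.size, ρ.val + 1 = J.size ↔ ρ = ρ₀ := fun ρ => by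
    rw [Fin.ext_iff]; simp only [hρ₀]; omega
  set α := Matrix.mulVec E⁻¹ (-Pi.single ρ₀ 1) with hα
  have hEα : E.mulVec α = -Pi.single ρ₀ 1 := by
    rw [hα, Matrix.mulVec_mulVec, Matrix.mul_nonsing_inv _ (isUnit_iff_ne_zero.2 hτ),
      Matrix.one_mulVec]
  have hrow : ∀ ρ : Fin J.size, ∑ c, rowDW μ R J ξ (polyB S) (n + 1 - J.size + ρ) c * α c =
      if ρ.val + 1 = J.size then -1 else 0 := fun ρ => by
    have h1 := congrFun hEα ρ
    simp only [Matrix.mulVec, dotProduct, hE, Matrix.of_apply, Pi.neg_apply, Pi.single_apply] at h1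
    rw [h1]
    simp only [hρ]
    split_ifs <;> simp
  have hA := (h.isConnected hLU hLU').right_formula (n := n) hs (by omega) (α := α) fun ρ => by
    simpa only [h.rowDW_eq] using hrow ρ
  have hdet : ∀ c, detA μ R J ξ (polyA Sbar H) (polyB S) n c x =
      -((fun d => rowK μ R J ξ (polyA Sbar H) (polyB S) (n - J.num) c x d + rowP J c x d) ⬝ᵥ α) *
        tau μ R J ξ (polyB S) n := fun c => by
    rw [show tau μ R J ξ (polyB S) n = E.det from rfl, ← det_updateRow_eq hτ ρ₀ hEα, detA]
    congr 1
    ext ρ d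
    simp only [Matrix.of_apply, Matrix.updateRow_apply, hρ]
  -- The summation bound n - M may exceed n - s. The extra rows 𝔼_ν, n - s < ν ≤ n - M, are
  -- annihilated by α; M ≤ s ensures no term is missing, and M ≥ 1 keeps out 𝔼_n, the one row among
  -- these that pairs nontrivially with α.
  have hK : ∀ c, ∑ d, rowK μ R J ξ (polyA Sbar H) (polyB S) (n - J.num) c x d * α d =
      ∑ ν ∈ Finset.range (n + 1 - J.size), (polyA Sbar H ν c).eval x *
        ∑ d, rowDW μ R J ξ (polyB S) ν d * α d := fun c => by
    simp only [rowK, Finset.sum_mul, mul_assoc]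
    rw [Finset.sum_comm]
    simp only [← Finset.mul_sum]
    refine (Finset.sum_subset (Finset.range_subset_range.2 (by omega)) fun ν hν hν' => ?_).symm
    rw [Finset.mem_range] at hν hν'
    have h1 := hrow ⟨ν - (n + 1 - J.size), by omega⟩
    simp only at h1
    rw [if_neg (by omega), show n + 1 - J.size + (ν - (n + 1 - J.size)) = ν by omega] at h1
    rw [h1, mul_zero]
  have hxp : ∀ i, x ≠ J.pt i := fun i hi => hx ((h.canonical.eigenvalue x).2 ⟨i, hi.symm⟩)
  have hleft : (polyA Sbar' H' n a).eval x =
      ∑ c, (R a c).eval x * ((∑ d, rowP J c x d * α d) +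
        ∑ ν ∈ Finset.range (n + 1 - J.size), (polyA Sbar H ν c).eval x *
          ∑ d, rowDW μ R J ξ (polyB S) ν d * α d) := by
    rw [hA]
    simp only [← h.rowDW_eq, Pi.add_apply, Finset.sum_apply, Pi.smul_apply, mulColumn_apply,
      Polynomial.eval_add, Polynomial.eval_finsetSum, Polynomial.eval_smul, Polynomial.eval_mul,
      smul_eq_mul, h.canonical.eval_poleQuot _ _ hxp, mul_add, Finset.sum_add_distrib]
    congr 1
    · simp only [Finset.mul_sum]
      rw [Finset.sum_comm]
      exact Finset.sum_congr rfl fun c _ => Finset.sum_congr rfl fun d _ => by ring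
    · rw [Finset.sum_congr rfl fun ν _ => Finset.mul_sum _ _ _, Finset.sum_comm]
      refine Finset.sum_congr rfl fun c _ => ?_
      rw [Finset.mul_sum]
      exact Finset.sum_congr rfl fun ν _ => by ring
  rw [hleft, ← Finset.sum_neg_distrib]
  refine Finset.sum_congr rfl fun c _ => ?_
  rw [hdet c, dotProduct, div_mul_eq_mul_div, mul_left_comm, mul_div_assoc]
  simp only [add_mul, Finset.sum_add_distrib]
  rw [hK c]
  field_simp
  ring

end IsGeronimus

end Formulas

end MixedOP

end

theorem mainTheorem3 {p q N r : ℕ} [NeZero p] [NeZero q] (hN : 1 ≤ N) (hr : r < p)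
    (R : Matrix (Fin p) (Fin p) (Polynomial ℂ)) (hR : MixedOP.IsNormalized N r R)
    (J : MixedOP.ChainData p) (hJ : J.IsCanonical R)
    (μ : Fin q → Fin p → ComplexMeasure ℝ) (Δ : Set ℝ) (hΔ : IsClosed Δ)
    (hsupp : ∀ b a, (μ b a).variation Δᶜ = 0)
    (hmom : ∀ b a, ∀ n : ℕ, (μ b a).Integrable (fun t : ℝ => (t : ℂ) ^ n))
    (hspec : ∀ t ∈ Δ, R.det.eval (t : ℂ) ≠ 0)
    (ξ : MixedOP.MassFunctions J q)
    (hξ : ∀ i j, ∀ k < J.len i j, ContDiffAt ℂ k (ξ i j k) (J.pt i))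
    (S Sbar : ℕ → ℕ → ℂ) (H : ℕ → ℂ)
    (hLU : MixedOP.IsGaussBorel (MixedOP.momentMatrix (MixedOP.ofMeasures μ)) S H Sbar)
    (S' Sbar' : ℕ → ℕ → ℂ) (H' : ℕ → ℂ)
    (hLU' : MixedOP.IsGaussBorel
      (MixedOP.momentMatrix (MixedOP.perturbed μ R J ξ)) S' H' Sbar') :
    -- the total number of masses
    J.size = N * p - r ∧
    -- the perturbed functional is a Geronimus perturbation of the original one
    (∀ (b : Fin q) (a : Fin p) (f : Polynomial ℂ),
      ∑ c, MixedOP.perturbed μ R J ξ b c (fun t => f.eval t * (R c a).eval t) =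
        MixedOP.ofMeasures μ b a (fun t => f.eval t)) ∧
    -- the limits that define the blocks `𝕎` exist
    (∀ n i j, ∀ k < J.len i j,
      Tendsto (MixedOP.preW R J ξ (MixedOP.polyB S) n i j k) (𝓝[≠] (J.pt i))
        (𝓝 (MixedOP.blockW R J ξ (MixedOP.polyB S) n i j k))) ∧
    -- the Christoffel-type formulas
    ∀ n : ℕ, N * p - r ≤ n →
      MixedOP.tau μ R J ξ (MixedOP.polyB S) n ≠ 0 ∧
      MixedOP.tau μ R J ξ (MixedOP.polyB S) (n - 1) ≠ 0 ∧
      (∀ (a : Fin p) (x : ℂ), R.det.eval x ≠ 0 →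
        (MixedOP.polyA Sbar' H' n a).eval x =
          -∑ c, (R a c).eval x / MixedOP.tau μ R J ξ (MixedOP.polyB S) n *
            MixedOP.detA μ R J ξ (MixedOP.polyA Sbar H) (MixedOP.polyB S) n c x) ∧
      (∀ (b : Fin q) (x : ℂ),
        (MixedOP.polyB S' n b).eval x =
          1 / MixedOP.tau μ R J ξ (MixedOP.polyB S) (n - 1) *
            MixedOP.detB μ R J ξ (MixedOP.polyB S) n b x) := by

  have h : MixedOP.IsGeronimus N r R J μ Δ ξ :=
    ⟨hN, hr, hR, hJ, hΔ, hsupp, hmom, hspec, hξ⟩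
  refine ⟨h.size_eq, fun b a f => ?_, fun n i j k _ => ?_, fun n hn => ?_⟩
  · rw [← h.sum_perturbed_mul b a f]
    refine Finset.sum_congr rfl fun c _ => ?_
    rw [h.perturbedPoly_eq]
    simp only [Polynomial.eval_mul]
  · rw [h.blockW_eq]
    exact h.tendsto_preW _ n i j k
  · rw [← h.size_eq] at hn
    exact ⟨h.tau_ne_zero hLU hLU' n, h.tau_ne_zero hLU hLU' (n - 1),
      fun a x hx => h.eval_polyA hLU hLU' hn a hx, fun b x => h.eval_polyB hLU hLU' hn b x⟩
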